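/- Let $d\ge 2$, $V=\{1,\dots,d\}$ and $1\le k\le d-1$. A junction tree on $V$ is a tree whose nodes (clusters) are subsets of $V$, none contained in another, with union $V$, such that every cluster on the path between two clusters $A,B$ contains $A\cap B$ (running intersection property); the separators are the sets $A\cap B$ for linked clusters $A,B$. A cherry tree of order $m$ is a junction tree all of whose clusters have size $m$ and all of whose separators have size $m-1$. A copula with density $c$ on $[0,1]^d$ is an $m$-th order cherry-tree copula if there is a cherry tree of order $m$ on $V$, with cluster set $\Gamma$ and separator set $\mathcal S$, such that for almost every $u$ $$c(u)=\frac{\prod_{K\in\Gamma}c_K(u_K)}{\prod_{S\in\mathcal S}c_S(u_S)^{\nu_S-1}},$$ where $c_K$, $c_S$ are the marginal densities of $c$, $\nu_S$ is the number of clusters containing $S$, and $0/0=0$. A regular vine on $V$ is a sequence $T_1,\dots,T_{d-1}$ in which $T_j$ is a cherry tree of order $j$ on $V$ (so $T_1$ is a tree on the singletons of $V$) and the clusters of $T_{j+1}$ are the unions $A\cup B$ of linked clusters $A,B$ of $T_j$. Let $X=(X_1,\dots,X_d)$ have a joint density. To linked clusters $A=S\cup\{a\}$ and $B=S\cup\{b\}$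 of some $T_j$, where $S=A\cap B$, belongs the pair copula $C_{a,b|S}(\cdot,\cdot\,|\,x_S)$, the copula of the conditional distribution of $(X_a,X_b)$ given $X_S=x_S$; it may depend on $x_S$, and $S$ is called its conditioning set. The copula of $X$ is a regular-vine copula truncated at level $k$ (with structure $T_1,\dots,T_{d-1}$) if all pair copulas of the vine whose conditioning set has size at least $k$ are independence copulas. **Theorem.** Every regular-vine copula truncated at level $k$ is a $(k+1)$-th order cherry-tree copula. -/

import Mathlib

open MeasureTheory ProbabilityTheory
open scoped ENNReal

noncomputable section

/-! ### Junction trees and cherry trees -/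

/-- A junction tree on the vertex set `V`: a tree whose nodes are the members of an antichain of
subsets of `V` (the clusters) that cover `V`, with the running intersection property. -/
structure JunctionTree (V : Type*) [Fintype V] [DecidableEq V] where
  /-- the clusters -/
  clusters : Finset (Finset V)
  /-- the tree that links the clusters -/
  graph : SimpleGraph clusters
  isTree : graph.IsTree
  cover : ∀ v : V, ∃ K ∈ clusters, v ∈ K
  antichain : ∀ K ∈ clusters, ∀ L ∈ clusters, K ⊆ L → K = L
  running_intersection : ∀ (A B : clusters) (p : graph.Walk A B), p.IsPath →
    ∀ K ∈ p.support, A.1 ∩ B.1 ⊆ K.1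

namespace JunctionTree

variable {V : Type*} [Fintype V] [DecidableEq V]

open Classical in
/-- The set of separators: the intersections of two linked clusters. -/
def separators (T : JunctionTree V) : Finset (Finset V) :=
  Finset.univ.filter fun S => ∃ A B : T.clusters, T.graph.Adj A B ∧ S = A.1 ∩ B.1

/-- `ν_S`: the number of clusters that contain `S`. -/
def nu (T : JunctionTree V) (S : Finset V) : ℕ :=
  (T.clusters.filter fun K => S ⊆ K).card

/-- A cherry tree of order `m`: all clusters have size `m`, all separators have size `m - 1`. -/
def IsCherryTree (T : JunctionTree V) (m : ℕ) : Prop :=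
  (∀ K ∈ T.clusters, K.card = m) ∧ ∀ S ∈ T.separators, S.card + 1 = m

end JunctionTree

/-! ### Distributions with a density, and junction tree distributions -/

/-- The density of the marginal distribution of the coordinates in `K`. -/
def marginalDensity {V : Type*} (P : Measure (V → ℝ)) (K : Finset V) : (K → ℝ) → ℝ≥0∞ :=
  (P.map K.restrict).rnDeriv volume

/-- `P` has a density, and this is the product of the marginal densities of the clusters divided
by the product of the marginal densities of the separators, each to the power `ν_S - 1`. -/
def IsJunctionTreeDistribution {V : Type*} [Fintype V] [DecidableEq V]
    (T : JunctionTree V) (P : Measure (V → ℝ)) : Prop :=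
  P ≪ volume ∧
    P.rnDeriv volume =ᵐ[volume] fun x =>
      (∏ K ∈ T.clusters, marginalDensity P K (K.restrict x)) /
        ∏ S ∈ T.separators, marginalDensity P S (S.restrict x) ^ (T.nu S - 1)

/-! ### Copulas -/

/-- A copula, as a probability measure whose one-dimensional marginals are uniform on `[0, 1]`. -/
def IsCopula {ι : Type*} (C : Measure (ι → ℝ)) : Prop :=
  IsProbabilityMeasure C ∧ ∀ i, C.map (fun u => u i) = volume.restrict (Set.Icc 0 1)

/-- `C` is a copula of the probability distribution `Q`, in the sense of Sklar:
`F(x) = C(F₁(x₁), …, Fₙ(xₙ))`, where `F` and `Fᵢ` are the distribution functions of `Q` and of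
its marginals. It is unique if the `Fᵢ` are continuous. -/
def IsCopulaOf {ι : Type*} (C Q : Measure (ι → ℝ)) : Prop :=
  IsCopula C ∧
    ∀ x : ι → ℝ, Q (Set.Iic x) = C (Set.Iic fun i => cdf (Q.map fun y => y i) (x i))

/-- The independence copula: the uniform distribution on the unit cube. -/
def independenceCopula (ι : Type*) [Fintype ι] : Measure (ι → ℝ) :=
  Measure.pi fun _ => volume.restrict (Set.Icc 0 1)

/-- A cherry-tree copula of order `m`: a copula whose density `c` satisfies
`c(u) = ∏_K c_K(u_K) / ∏_S c_S(u_S) ^ (ν_S - 1)` for a cherry tree of order `m`. Note that the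
marginal `c_K` of a copula density is the copula density of the coordinates in `K`. -/
def IsCherryTreeCopula {V : Type*} [Fintype V] [DecidableEq V] (m : ℕ) (C : Measure (V → ℝ)) :
    Prop :=
  IsCopula C ∧ ∃ T : JunctionTree V, T.IsCherryTree m ∧ IsJunctionTreeDistribution T C

/-! ### Regular vines -/

/-- A regular vine on `{1, …, d}`, as a sequence of cherry trees `T 1, …, T (d - 1)`, the tree
`T j` of order `j`, such that the clusters of `T (j + 1)` are the unions of two linked clusters of
`T j`. The clusters of `T 1` are the singletons, so that `T 1` is a tree on the vertices.
Values of `T` outside the range `1, …, d - 1` play no role. -/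
structure IsRegularVine {d : ℕ} (T : ℕ → JunctionTree (Fin d)) : Prop where
  isCherryTree : ∀ j, 1 ≤ j → j < d → (T j).IsCherryTree j
  clusters_succ : ∀ j, 1 ≤ j → j + 1 < d → ∀ K : Finset (Fin d),
    K ∈ (T (j + 1)).clusters ↔ ∃ A B : (T j).clusters, (T j).graph.Adj A B ∧ K = A.1 ∪ B.1

/-- A choice of bivariate copulas `C_{a,b|S}(· , · | z)`, which may depend on the value `z` of the
conditioning variables. -/
abbrev PairCopulas (d : ℕ) : Type :=
  Fin d → Fin d → (S : Finset (Fin d)) → (S → ℝ) → Measure (Fin 2 → ℝ)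

/-- The conditional distribution of `(X_a, X_b)` given `X_S`, for `X` with distribution `P`. -/
def condPairLaw {d : ℕ} (P : Measure (Fin d → ℝ)) [IsProbabilityMeasure P] (a b : Fin d)
    (S : Finset (Fin d)) : Kernel (S → ℝ) (Fin 2 → ℝ) :=
  condDistrib (fun x : Fin d → ℝ => ![x a, x b]) S.restrict P

/-- `P` is a regular-vine distribution with structure `T` and pair copulas `C`: it has a density,
and for all linked clusters `A`, `B` of a tree of the vine, with `S = A ∩ B`, `A = S ∪ {a}` and
`B = S ∪ {b}`, the copula of the conditional distribution of `(X_a, X_b)` given `X_S = z` is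
`C_{a,b|S}(· , · | z)`, for almost all `z`. -/
def IsRegularVineDistribution {d : ℕ} (T : ℕ → JunctionTree (Fin d)) (C : PairCopulas d)
    (P : Measure (Fin d → ℝ)) [IsProbabilityMeasure P] : Prop :=
  P ≪ volume ∧ IsRegularVine T ∧
    ∀ j, 1 ≤ j → j < d → ∀ A B : (T j).clusters, (T j).graph.Adj A B →
      ∀ a ∈ A.1 \ B.1, ∀ b ∈ B.1 \ A.1,
        ∀ᵐ z ∂(P.map (A.1 ∩ B.1).restrict),
          IsCopulaOf (C a b (A.1 ∩ B.1) z) (condPairLaw P a b (A.1 ∩ B.1) z)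

/-- All pair copulas of the vine whose conditioning set has size at least `k` are independence
copulas. -/
def IsTruncatedAtLevel {d : ℕ} (k : ℕ) (T : ℕ → JunctionTree (Fin d)) (C : PairCopulas d) :
    Prop :=
  ∀ j, 1 ≤ j → j < d → ∀ A B : (T j).clusters, (T j).graph.Adj A B →
    k ≤ (A.1 ∩ B.1).card → ∀ a ∈ A.1 \ B.1, ∀ b ∈ B.1 \ A.1,
      ∀ z, C a b (A.1 ∩ B.1) z = independenceCopula (Fin 2)

/-- A regular-vine copula truncated at level `k`: the copula of a regular-vine distribution whose
pair copulas with conditioning set of size at least `k` are independence copulas. -/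
def IsTruncatedRegularVineCopula {d : ℕ} (k : ℕ) (C : Measure (Fin d → ℝ)) : Prop :=
  ∃ (P : Measure (Fin d → ℝ)) (_ : IsProbabilityMeasure P) (T : ℕ → JunctionTree (Fin d))
    (c : PairCopulas d),
    IsRegularVineDistribution T c P ∧ IsTruncatedAtLevel k T c ∧ IsCopulaOf C P

end

/-! Let `c` be the copula density. If `A = S ∪ {a}` and `B = S ∪ {b}` are linked in `T j` and their
pair copula is the independence copula, then the coordinates `a` and `b` are conditionally
independent given `S`, which for densities means `c_{A∪B} = c_A c_B / c_S`. The separators of `T j`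
have size `j - 1`, so truncation at level `k` yields this for every edge of `T j` with `j ≥ k + 1`.

The product formula is trivial for the tree with the single cluster `V`, which serves as `T d`. It
descends from `T' = T (j + 1)` to `T = T j` as long as all edges of `T` factorize. The clusters of
`T'` are the edges of `T`, so their densities multiply to the product of `c_A c_B / c_{A∩B}` over
these edges. Here `c_A` occurs `deg A` times, and `c_S` occurs `ν_S - 1` times in the denominator
(`IsCherryTree.card_edges_add_one`). The separators of `T'` are clusters `A` of `T`, and `ν_A` in
`T'` is `deg A` (`IsNextCherryTree.nu_eq`); dividing by `c_A ^ (deg A - 1)` leaves each `c_A` once,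
which is the formula for `T`. Descending to `T (k + 1)` gives the theorem.

On the analytic side, conditional independence passes from the vine distribution to its copula
through quantile and distribution functions (`CondIndepCoords.copula`), the copula has a density on
the cube (`IsCopulaOf.absolutelyContinuous`), and conditional independence is turned into the
factorization by comparing integrals over boxes (`CondIndepCoords.density_union_ae_eq`). -/

/-! ### Combinatorics of cherry trees -/

namespace JunctionTree

variable {V : Type*} [Fintype V] [DecidableEq V]

/-- Every vertex of a connected graph is joined to an end of a given edge by a walk that avoids
this edge. -/
theorem reachable_deleteEdges_or {W : Type*} {G : SimpleGraph W} (hG : G.Connected) (C D A : W) :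
    (G.deleteEdges {s(C, D)}).Reachable A C ∨ (G.deleteEdges {s(C, D)}).Reachable A D := by
  obtain ⟨p⟩ := hG.preconnected A C
  suffices ∀ {X Y : W} (_ : G.Walk X Y), Y = C →
      (G.deleteEdges {s(C, D)}).Reachable X C ∨ (G.deleteEdges {s(C, D)}).Reachable X D from
    this p rfl
  intro X Y q hY
  induction q with
  | nil => subst hY; exact Or.inl (SimpleGraph.Reachable.refl _)
  | @cons X X' Y h q ih =>
    by_cases he : s(X, X') = s(C, D)
    · rcases Sym2.eq_iff.1 he with ⟨rfl, -⟩ | ⟨rfl, -⟩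
      · exact Or.inl (SimpleGraph.Reachable.refl _)
      · exact Or.inr (SimpleGraph.Reachable.refl _)
    · have hadj : (G.deleteEdges {s(C, D)}).Adj X X' := by
        rw [SimpleGraph.deleteEdges_adj]; exact ⟨h, he⟩
      exact (ih hY).imp hadj.reachable.trans hadj.reachable.trans

/-- If `A` is on the side of `C`, the path from `A` to `D` runs through `C`, and running
intersection applies. -/
theorem inter_subset_of_reachable (T : JunctionTree V) {A C D : T.clusters}
    (h : T.graph.Adj C D) (hr : (T.graph.deleteEdges {s(C, D)}).Reachable A C) :
    A.1 ∩ D.1 ⊆ C.1 := by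
  classical
  obtain ⟨p, hp⟩ := hr.exists_isPath
  -- Every edge of a tree is a bridge, so a walk that avoids the edge cannot reach `D` from the side
  -- of `C`.
  have hD : D ∉ p.support := fun hD =>
    SimpleGraph.isBridge_iff.1
      (SimpleGraph.isAcyclic_iff_forall_adj_isBridge.1 T.isTree.isAcyclic h)
      ((p.dropUntil D hD).reachable.symm)
  have hle := T.graph.deleteEdges_le {s(C, D)}
  have hq : ((p.mapLe hle).concat h).IsPath :=
    (hp.mapLe hle).concat (by simpa using hD) h
  exact T.running_intersection A D _ hq C (by simp [SimpleGraph.Walk.support_concat])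

theorem inter_union_subset_of_reachable (T : JunctionTree V) {A C D : T.clusters}
    (h : T.graph.Adj C D) (hr : (T.graph.deleteEdges {s(C, D)}).Reachable A C) :
    A.1 ∩ (C.1 ∪ D.1) ⊆ C.1 := by
  rw [Finset.inter_union_distrib_left]
  exact Finset.union_subset Finset.inter_subset_right (T.inter_subset_of_reachable h hr)

theorem deleteEdges_swap {W : Type*} (G : SimpleGraph W) (C D : W) :
    G.deleteEdges {s(C, D)} = G.deleteEdges {s(D, C)} := by rw [Sym2.eq_swap]

/-- A cluster that is contained in the union of two linked clusters is one of them. -/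
theorem eq_or_eq_of_subset_union (T : JunctionTree V) {A C D : T.clusters}
    (h : T.graph.Adj C D) (hA : A.1 ⊆ C.1 ∪ D.1) : A = C ∨ A = D := by
  rcases reachable_deleteEdges_or T.isTree.connected C D A with hr | hr
  · refine Or.inl (Subtype.ext (T.antichain _ A.2 _ C.2 ?_))
    have := T.inter_union_subset_of_reachable h hr
    rwa [Finset.inter_eq_left.2 hA] at this
  · refine Or.inr (Subtype.ext (T.antichain _ A.2 _ D.2 ?_))
    rw [deleteEdges_swap] at hr
    have := T.inter_union_subset_of_reachable h.symm hr
    rwa [Finset.union_comm, Finset.inter_eq_left.2 hA] at this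

/-- The intersection of the unions of two distinct pairs of linked clusters is contained in a
cluster of the second pair. -/
theorem union_inter_union_subset (T : JunctionTree V) {A B C D : T.clusters}
    (hAB : T.graph.Adj A B) (hCD : T.graph.Adj C D) (hne : s(A, B) ≠ s(C, D)) :
    (A.1 ∪ B.1) ∩ (C.1 ∪ D.1) ⊆ C.1 ∨ (A.1 ∪ B.1) ∩ (C.1 ∪ D.1) ⊆ D.1 := by
  -- The edge `AB` survives the deletion of `CD`, so `A` and `B` are on the same side of it.
  have hadj : (T.graph.deleteEdges {s(C, D)}).Adj B A := by
    rw [SimpleGraph.deleteEdges_adj]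
    exact ⟨hAB.symm, fun h => hne (Sym2.eq_swap.trans h)⟩
  rw [Finset.union_inter_distrib_right]
  rcases reachable_deleteEdges_or T.isTree.connected C D A with hr | hr
  · exact Or.inl (Finset.union_subset (T.inter_union_subset_of_reachable hCD hr)
      (T.inter_union_subset_of_reachable hCD (hadj.reachable.trans hr)))
  · have hr' := hadj.reachable.trans hr
    rw [deleteEdges_swap] at hr hr'
    rw [Finset.union_comm C.1 D.1]
    exact Or.inr (Finset.union_subset (T.inter_union_subset_of_reachable hCD.symm hr)
      (T.inter_union_subset_of_reachable hCD.symm hr'))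

/-- The union of the two clusters of a pair. -/
def edgeUnion (T : JunctionTree V) (e : Sym2 T.clusters) : Finset V :=
  Sym2.lift ⟨fun A B => A.1 ∪ B.1, fun _ _ => Finset.union_comm _ _⟩ e

/-- The intersection of the two clusters of a pair. -/
def edgeInter (T : JunctionTree V) (e : Sym2 T.clusters) : Finset V :=
  Sym2.lift ⟨fun A B => A.1 ∩ B.1, fun _ _ => Finset.inter_comm _ _⟩ e

@[simp] theorem edgeUnion_mk (T : JunctionTree V) (A B : T.clusters) :
    T.edgeUnion s(A, B) = A.1 ∪ B.1 := rfl

@[simp] theorem edgeInter_mk (T : JunctionTree V) (A B : T.clusters) :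
    T.edgeInter s(A, B) = A.1 ∩ B.1 := rfl

theorem mem_of_subset_edgeUnion (T : JunctionTree V) {A : T.clusters} {e : Sym2 T.clusters}
    (he : e ∈ T.graph.edgeSet) (hA : A.1 ⊆ T.edgeUnion e) : A ∈ e := by
  induction e with | _ C D => ?_
  simpa using T.eq_or_eq_of_subset_union he hA

theorem subset_edgeUnion_of_mem (T : JunctionTree V) {A : T.clusters} {e : Sym2 T.clusters}
    (hA : A ∈ e) : A.1 ⊆ T.edgeUnion e := by
  induction e with | _ C D => ?_
  rcases Sym2.mem_iff.1 hA with rfl | rfl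
  · exact Finset.subset_union_left
  · exact Finset.subset_union_right

/-- An edge is recovered from its union, since its ends are the only clusters contained there. Hence
the clusters of the next tree correspond one-to-one to edges. -/
theorem edgeUnion_injOn (T : JunctionTree V) : Set.InjOn T.edgeUnion T.graph.edgeSet := by
  intro e he f hf h
  induction e with | _ A B => ?_
  have hA := T.mem_of_subset_edgeUnion (A := A) hf (h ▸ T.subset_edgeUnion_of_mem (by simp))
  have hB := T.mem_of_subset_edgeUnion (A := B) hf (h ▸ T.subset_edgeUnion_of_mem (by simp))
  exact ((Sym2.mem_and_mem_iff (SimpleGraph.Adj.ne he)).1 ⟨hA, hB⟩).symm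

/-- `T'` is a cherry tree of order `j + 1` whose clusters are the unions of two linked clusters of
the cherry tree `T` of order `j`. -/
structure IsNextCherryTree (T T' : JunctionTree V) (j : ℕ) : Prop where
  isCherryTree : T.IsCherryTree j
  isCherryTree_next : T'.IsCherryTree (j + 1)
  mem_clusters : ∀ K : Finset V,
    K ∈ T'.clusters ↔ ∃ A B : T.clusters, T.graph.Adj A B ∧ K = A.1 ∪ B.1

theorem mem_separators (T : JunctionTree V) {S : Finset V} :
    S ∈ T.separators ↔ ∃ A B : T.clusters, T.graph.Adj A B ∧ S = A.1 ∩ B.1 := by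
  simp [separators]

/-- If two distinct clusters of a cherry tree contain a set of the size of its separators, this
set is a separator. -/
theorem IsCherryTree.mem_separators_of_subset {T : JunctionTree V} {m : ℕ} (h : T.IsCherryTree m)
    {S : Finset V} (hS : S.card + 1 = m) {K L : T.clusters} (hne : K ≠ L) (hK : S ⊆ K.1)
    (hL : S ⊆ L.1) : S ∈ T.separators := by
  obtain ⟨p, hp⟩ := T.isTree.connected.exists_isPath K L
  have hsub := T.running_intersection K L p hp
  cases p with
  | nil => exact absurd rfl hne
  | @cons _ M _ hKM q =>
    -- The neighbour `M` of `K` on the path to `L` contains `S` too, so the separator `K ∩ M`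
    -- contains `S` and has the same size.
    have hM : S ⊆ M.1 := (Finset.subset_inter hK hL).trans (hsub M (by simp))
    have hmem : K.1 ∩ M.1 ∈ T.separators := T.mem_separators.2 ⟨K, M, hKM, rfl⟩
    have hcard := h.2 _ hmem
    rwa [Finset.eq_of_subset_of_card_le (Finset.subset_inter hK hM) (by omega)]

open Classical in
/-- The number of edges of a cherry tree with separator `S` is `ν_S - 1`. -/
theorem IsCherryTree.card_edges_add_one {T : JunctionTree V} {m : ℕ} (h : T.IsCherryTree m)
    {S : Finset V} (hS : S ∈ T.separators) :
    (T.graph.edgeFinset.filter fun e => T.edgeInter e = S).card + 1 = T.nu S := by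
  obtain ⟨A₀, B₀, -, hS₀⟩ := T.mem_separators.1 hS
  have hScard := h.2 S hS
  let s : Set T.clusters := {A | S ⊆ A.1}
  -- By running intersection the clusters that contain `S` span a subtree. It has `ν_S` vertices,
  -- hence `ν_S - 1` edges, and for reasons of size these are the edges with separator `S`.
  have hconn : (T.graph.induce s).Connected := by
    have : Nonempty s := ⟨⟨A₀, by simp [s, hS₀]⟩⟩
    refine ⟨fun A B => ?_⟩
    obtain ⟨p, hp⟩ := T.isTree.connected.exists_isPath A.1 B.1
    exact ⟨p.induce s fun K hK =>
      (Finset.subset_inter A.2 B.2).trans (T.running_intersection _ _ p hp K hK)⟩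
  have htree : (T.graph.induce s).IsTree := ⟨hconn, T.isTree.isAcyclic.induce s⟩
  have hcard := htree.card_edgeFinset
  have h1 : Fintype.card s = T.nu S := by
    rw [nu, ← Fintype.card_coe]
    refine Fintype.card_congr
      { toFun := fun A => ⟨A.1.1, Finset.mem_filter.2 ⟨A.1.2, A.2⟩⟩
        invFun := fun K => ⟨⟨K.1, (Finset.mem_filter.1 K.2).1⟩, (Finset.mem_filter.1 K.2).2⟩
        left_inv := fun _ => rfl
        right_inv := fun _ => rfl }
  have h2 : (T.graph.induce s).edgeFinset.card =
      (T.graph.edgeFinset.filter fun e => T.edgeInter e = S).card := by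
    refine Finset.card_bij (fun e _ => e.map Subtype.val) ?_ ?_ ?_
    · intro e he
      induction e with | _ A B => ?_
      have hadj : T.graph.Adj A.1 B.1 := by simpa using he
      have hc := h.2 _ (T.mem_separators.2 ⟨A.1, B.1, hadj, rfl⟩)
      simp only [Finset.mem_filter, SimpleGraph.mem_edgeFinset, Sym2.map_mk, edgeInter_mk]
      exact ⟨hadj, (Finset.eq_of_subset_of_card_le (Finset.subset_inter A.2 B.2)
        (by omega)).symm⟩
    · intro e _ f _ hef
      exact Sym2.map.injective Subtype.val_injective hef
    · intro e he
      induction e with | _ A B => ?_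
      obtain ⟨hadj, hAB⟩ := Finset.mem_filter.1 he
      rw [edgeInter_mk] at hAB
      refine ⟨s(⟨A, ?_⟩, ⟨B, ?_⟩), ?_, rfl⟩
      · exact hAB.symm.subset.trans Finset.inter_subset_left
      · exact hAB.symm.subset.trans Finset.inter_subset_right
      · simpa using hadj
  rw [← h1, ← hcard, h2]

/-! ### Consecutive trees of a vine -/

namespace IsNextCherryTree

variable {T T' : JunctionTree V} {j : ℕ}

/-- The intersection of two distinct edge unions lies in a cluster of `T`. Both have size `j`, so
they agree. -/
theorem separators_subset (h : IsNextCherryTree T T' j) : T'.separators ⊆ T.clusters := by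
  intro S hS
  have hcard := h.isCherryTree_next.2 S hS
  obtain ⟨K, L, hKL, rfl⟩ := T'.mem_separators.1 hS
  obtain ⟨A, B, hAB, hK⟩ := (h.mem_clusters K).1 K.2
  obtain ⟨C, D, hCD, hL⟩ := (h.mem_clusters L).1 L.2
  have hne : s(A, B) ≠ s(C, D) := fun heq => hKL.ne (Subtype.ext (by
    rw [hK, hL, ← edgeUnion_mk, ← edgeUnion_mk, heq]))
  rw [hK, hL] at hcard ⊢
  have hC := h.isCherryTree.1 C C.2
  have hD := h.isCherryTree.1 D D.2
  rcases T.union_inter_union_subset hAB hCD hne with hs | hs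
  · rw [Finset.eq_of_subset_of_card_le hs (by omega)]; exact C.2
  · rw [Finset.eq_of_subset_of_card_le hs (by omega)]; exact D.2

open Classical in
theorem clusters_eq_image (h : IsNextCherryTree T T' j) :
    T'.clusters = T.graph.edgeFinset.image T.edgeUnion := by
  ext K
  rw [h.mem_clusters, Finset.mem_image]
  constructor
  · rintro ⟨A, B, hAB, rfl⟩
    exact ⟨s(A, B), by simpa using hAB, rfl⟩
  · rintro ⟨e, he, rfl⟩
    induction e with | _ A B => ?_
    exact ⟨A, B, by simpa using he, rfl⟩

open Classical in
theorem prod_clusters (h : IsNextCherryTree T T' j) {M : Type*} [CommMonoid M]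
    (φ : Finset V → M) :
    ∏ K ∈ T'.clusters, φ K = ∏ e ∈ T.graph.edgeFinset, φ (T.edgeUnion e) := by
  rw [h.clusters_eq_image, Finset.prod_image]
  simpa using T.edgeUnion_injOn

open Classical in
-- An edge union contains `A` exactly if `A` is an end of the edge, so `ν_A` in `T'` is the degree
-- of `A` in `T`.
theorem nu_eq (h : IsNextCherryTree T T' j) (A : T.clusters) :
    T'.nu A.1 = (T.graph.edgeFinset.filter fun e => A ∈ e).card := by
  rw [nu, h.clusters_eq_image, Finset.filter_image, Finset.card_image_of_injOn]
  · congr 1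
    refine Finset.filter_congr fun e he => ?_
    exact ⟨T.mem_of_subset_edgeUnion (by simpa using he), T.subset_edgeUnion_of_mem⟩
  · exact T.edgeUnion_injOn.mono fun e he => by
      simpa using (Finset.mem_filter.1 (Finset.mem_coe.1 he)).1

/-- A cluster of `T` that is not a separator of `T'` lies in at most one cluster of `T'`, so its
exponent is `0`. -/
theorem prod_separators (h : IsNextCherryTree T T' j) {M : Type*} [CommMonoid M]
    (φ : Finset V → M) :
    ∏ S ∈ T'.separators, φ S ^ (T'.nu S - 1) = ∏ A ∈ T.clusters, φ A ^ (T'.nu A - 1) := by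
  refine Finset.prod_subset h.separators_subset fun A hA hAS => ?_
  have hle : T'.nu A ≤ 1 := by
    by_contra hlt
    obtain ⟨K, hK, L, hL, hne⟩ := Finset.one_lt_card.1 (not_le.1 hlt)
    rw [Finset.mem_filter] at hK hL
    refine hAS (h.isCherryTree_next.mem_separators_of_subset (K := ⟨K, hK.1⟩) (L := ⟨L, hL.1⟩)
      (by rw [h.isCherryTree.1 A hA]) (fun heq => hne (congrArg Subtype.val heq)) hK.2 hL.2)
  rw [Nat.sub_eq_zero_of_le hle, pow_zero]

/-- Every cluster of `T` is contained in a cluster of `T'`. -/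
theorem exists_subset (h : IsNextCherryTree T T' j) (A : T.clusters) :
    ∃ K ∈ T'.clusters, A.1 ⊆ K := by
  obtain ⟨K₀⟩ := T'.isTree.connected.nonempty
  obtain ⟨B, C, hBC, -⟩ := (h.mem_clusters K₀).1 K₀.2
  obtain ⟨D, hD⟩ : ∃ D, T.graph.Adj A D := by
    by_cases hA : A = B
    · exact ⟨C, hA ▸ hBC⟩
    · obtain ⟨p⟩ := T.isTree.connected.preconnected A B
      cases p with
      | nil => exact absurd rfl hA
      | cons hadj _ => exact ⟨_, hadj⟩
  exact ⟨A.1 ∪ D.1, (h.mem_clusters _).2 ⟨A, D, hD, rfl⟩, Finset.subset_union_left⟩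

theorem nu_pos (h : IsNextCherryTree T T' j) (A : T.clusters) : 0 < T'.nu A.1 := by
  obtain ⟨K, hK, hAK⟩ := h.exists_subset A
  exact Finset.card_pos.2 ⟨K, Finset.mem_filter.2 ⟨hK, hAK⟩⟩

end IsNextCherryTree

open Classical in
/-- In a cherry tree the product over the edges of a function of the separator is the product over
the separators with multiplicity `ν_S - 1`. -/
theorem IsCherryTree.prod_edgeInter {T : JunctionTree V} {m : ℕ} (h : T.IsCherryTree m)
    {M : Type*} [CommMonoid M] (φ : Finset V → M) :
    ∏ e ∈ T.graph.edgeFinset, φ (T.edgeInter e) =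
      ∏ S ∈ T.separators, φ S ^ (T.nu S - 1) := by
  have hmaps : ∀ e ∈ T.graph.edgeFinset, T.edgeInter e ∈ T.separators := by
    intro e he
    induction e with | _ A B => ?_
    exact T.mem_separators.2 ⟨A, B, by simpa using he, rfl⟩
  rw [← Finset.prod_fiberwise_of_maps_to hmaps]
  refine Finset.prod_congr rfl fun S hS => ?_
  rw [Finset.prod_congr rfl fun e he => by rw [(Finset.mem_filter.1 he).2], Finset.prod_const,
    ← h.card_edges_add_one hS, Nat.add_sub_cancel]

open Classical in
/-- The product over the edges of a graph of the values of a function at both ends. -/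
theorem prod_edges_mul {W M : Type*} [Fintype W] [CommMonoid M] (G : SimpleGraph W) (φ : W → M) :
    ∏ e ∈ G.edgeFinset, Sym2.lift ⟨fun A B => φ A * φ B, fun _ _ => mul_comm _ _⟩ e =
      ∏ A, φ A ^ (G.edgeFinset.filter fun e => A ∈ e).card := by
  have h1 : ∀ e ∈ G.edgeFinset,
      Sym2.lift ⟨fun A B => φ A * φ B, fun _ _ => mul_comm _ _⟩ e =
        ∏ A, if A ∈ e then φ A else 1 := by
    intro e he
    induction e with | _ A B => ?_
    have hne : A ≠ B := SimpleGraph.Adj.ne (by simpa using he)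
    rw [← Finset.prod_filter]
    have : Finset.univ.filter (fun C => C ∈ s(A, B)) = {A, B} := by ext; simp
    rw [this, Finset.prod_pair hne]
    rfl
  rw [Finset.prod_congr rfl h1, Finset.prod_comm]
  refine Finset.prod_congr rfl fun A _ => ?_
  rw [← Finset.prod_filter, Finset.prod_const]

/-- The passage from `T'` to `T` in the product formula of a junction tree. -/
theorem IsNextCherryTree.prod_div_prod {T T' : JunctionTree V} {j : ℕ}
    (h : IsNextCherryTree T T' j) {M : Type*} [CommGroupWithZero M] (φ : Finset V → M)
    (hφ : ∀ A ∈ T.clusters, φ A ≠ 0)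
    (hfac : ∀ A B : T.clusters, T.graph.Adj A B →
      φ (A.1 ∪ B.1) = φ A.1 * φ B.1 / φ (A.1 ∩ B.1)) :
    (∏ K ∈ T'.clusters, φ K) / ∏ S ∈ T'.separators, φ S ^ (T'.nu S - 1) =
      (∏ A ∈ T.clusters, φ A) / ∏ S ∈ T.separators, φ S ^ (T.nu S - 1) := by
  classical
  -- Multiplying `hfac` over the edges of `T` produces `φ A` once for each edge at `A`, that is,
  -- `T'.nu A` times.
  have h1 : ∏ K ∈ T'.clusters, φ K =
      (∏ A ∈ T.clusters, φ A ^ T'.nu A) / ∏ S ∈ T.separators, φ S ^ (T.nu S - 1) := by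
    have h2 := (prod_edges_mul T.graph fun A => φ A.1).trans
      (Finset.prod_congr rfl fun A _ => show _ = φ A.1 ^ T'.nu A.1 by rw [h.nu_eq A]; congr!)
    rw [h.prod_clusters, ← h.isCherryTree.prod_edgeInter φ,
      ← Finset.prod_coe_sort T.clusters fun A => φ A ^ T'.nu A, ← h2, ← Finset.prod_div_distrib]
    refine Finset.prod_congr rfl fun e he => ?_
    induction e with | _ A B => ?_
    exact hfac A B (by simpa using he)
  rw [h1, h.prod_separators, div_right_comm, ← Finset.prod_div_distrib]
  congr 1
  refine Finset.prod_congr rfl fun A hA => ?_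
  rw [div_eq_iff (pow_ne_zero _ (hφ A hA)), ← pow_succ',
    Nat.sub_add_cancel (h.nu_pos ⟨A, hA⟩)]

/-- The passage from `T'` to `T` in the product formula of a junction tree, for values that may
vanish. -/
theorem IsNextCherryTree.ennreal_prod_div_prod {T T' : JunctionTree V} {j : ℕ}
    (h : IsNextCherryTree T T' j) (φ : Finset V → ℝ≥0∞) (hfin : ∀ K, φ K ≠ ∞)
    (hzero : ∀ S A, S ⊆ A → φ S = 0 → φ A = 0)
    (hfac : ∀ A B : T.clusters, T.graph.Adj A B →
      φ (A.1 ∪ B.1) = φ A.1 * φ B.1 / φ (A.1 ∩ B.1)) :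
    (∏ K ∈ T'.clusters, φ K) / ∏ S ∈ T'.separators, φ S ^ (T'.nu S - 1) =
      (∏ A ∈ T.clusters, φ A) / ∏ S ∈ T.separators, φ S ^ (T.nu S - 1) := by
  by_cases hφ : ∀ A ∈ T.clusters, φ A ≠ 0
  · have hsep : ∀ S ∈ T.separators, φ S ≠ 0 := by
      intro S hS h0
      obtain ⟨A, B, -, rfl⟩ := T.mem_separators.1 hS
      exact hφ A A.2 (hzero _ _ Finset.inter_subset_left h0)
    have hcoe : ∀ K, φ K = ((φ K).toNNReal : ℝ≥0∞) := fun K => (ENNReal.coe_toNNReal (hfin K)).symm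
    have hne : ∀ K, φ K ≠ 0 → (φ K).toNNReal ≠ 0 := fun K hK h0 =>
      (ENNReal.toNNReal_eq_zero_iff _).1 h0 |>.elim hK (hfin K)
    have key := h.prod_div_prod (fun K => (φ K).toNNReal) (fun A hA => hne A (hφ A hA))
      (fun A B hAB => by
        simp only [hfac A B hAB, ENNReal.toNNReal_div, ENNReal.toNNReal_mul])
    have hd' : ∏ S ∈ T'.separators, (φ S).toNNReal ^ (T'.nu S - 1) ≠ 0 :=
      Finset.prod_ne_zero_iff.2 fun S hS =>
        pow_ne_zero _ (hne S (hφ S (h.separators_subset hS)))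
    have hd : ∏ S ∈ T.separators, (φ S).toNNReal ^ (T.nu S - 1) ≠ 0 :=
      Finset.prod_ne_zero_iff.2 fun S hS => pow_ne_zero _ (hne S (hsep S hS))
    have key' := congrArg ((↑) : NNReal → ℝ≥0∞) key
    rw [ENNReal.coe_div hd', ENNReal.coe_div hd] at key'
    push_cast at key'
    simpa only [← hcoe] using key'
  -- If the value at a cluster `A` of `T` is zero, so is the value at a cluster of `T'` containing
  -- `A`. Both numerators vanish, and `0 / x = 0` for every `x` in `ℝ≥0∞`.
  · push Not at hφ
    obtain ⟨A, hA, h0⟩ := hφ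
    obtain ⟨K, hK, hAK⟩ := h.exists_subset ⟨A, hA⟩
    rw [Finset.prod_eq_zero hK (hzero A K hAK h0), Finset.prod_eq_zero hA h0,
      ENNReal.zero_div, ENNReal.zero_div]

/-- The junction tree with the single cluster `V`. -/
def single (V : Type*) [Fintype V] [DecidableEq V] : JunctionTree V where
  clusters := {Finset.univ}
  graph := ⊥
  isTree := SimpleGraph.IsTree.of_subsingleton
  cover v := ⟨Finset.univ, by simp, Finset.mem_univ v⟩
  antichain K hK L hL _ := by rw [Finset.mem_singleton.1 hK, Finset.mem_singleton.1 hL]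
  running_intersection A B p _ K _ := by
    rw [Finset.mem_singleton.1 K.2]; exact Finset.subset_univ _

@[simp] theorem clusters_single : (single V).clusters = {Finset.univ} := rfl

@[simp] theorem separators_single : (single V).separators = ∅ := by
  ext S
  simp only [mem_separators, Finset.notMem_empty, iff_false]
  rintro ⟨A, B, hAB, -⟩
  exact hAB

theorem isCherryTree_single : (single V).IsCherryTree (Fintype.card V) := by
  constructor <;> simp

/-- In a cherry tree, linked clusters differ in one element each. -/
theorem IsCherryTree.exists_insert_inter {T : JunctionTree V} {m : ℕ} (h : T.IsCherryTree m)
    {A B : T.clusters} (hAB : T.graph.Adj A B) :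
    ∃ a ∈ A.1 \ B.1, A.1 = insert a (A.1 ∩ B.1) := by
  have h1 := h.2 _ (T.mem_separators.2 ⟨A, B, hAB, rfl⟩)
  have h2 := h.1 A A.2
  have h3 := Finset.card_sdiff_add_card_inter A.1 B.1
  obtain ⟨a, ha⟩ := Finset.card_eq_one.1 (show (A.1 \ B.1).card = 1 by omega)
  refine ⟨a, by simp [ha], ?_⟩
  rw [Finset.insert_eq, ← ha, Finset.sdiff_union_inter]

/-- A cherry tree of order `|V| - 1` has two clusters, and they are linked. -/
theorem IsCherryTree.isNextCherryTree_single {T : JunctionTree V} {m : ℕ} (h : T.IsCherryTree m)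
    (hm : m + 1 = Fintype.card V) : IsNextCherryTree T (single V) m := by
  refine ⟨h, hm ▸ isCherryTree_single, fun K => ?_⟩
  have hunion : ∀ A B : T.clusters, T.graph.Adj A B → A.1 ∪ B.1 = Finset.univ := by
    intro A B hAB
    have h1 := h.2 _ (T.mem_separators.2 ⟨A, B, hAB, rfl⟩)
    have h2 := h.1 A A.2
    have h3 := h.1 B B.2
    have h4 := Finset.card_union_add_card_inter A.1 B.1
    exact (Finset.card_eq_iff_eq_univ _).1 (by omega)
  rw [clusters_single, Finset.mem_singleton]
  constructor
  · rintro rfl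
    obtain ⟨A⟩ := T.isTree.connected.nonempty
    obtain ⟨v, hv⟩ : ∃ v, v ∉ A.1 := by
      by_contra! hall
      have h2 := h.1 A A.2
      rw [Finset.eq_univ_iff_forall.2 hall, Finset.card_univ] at h2
      omega
    obtain ⟨B, hB, hvB⟩ := T.cover v
    obtain ⟨p⟩ := T.isTree.connected.preconnected A ⟨B, hB⟩
    cases p with
    | nil => exact absurd hvB hv
    | cons hadj _ => exact ⟨A, _, hadj, (hunion _ _ hadj).symm⟩
  · rintro ⟨A, B, hAB, rfl⟩
    exact hunion A B hAB

end JunctionTree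

/-! ### Conditional independence and marginal densities -/

section

variable {V : Type*}

/-- The coordinates `a` and `b` are conditionally independent given the coordinates in `S`: for all
events `I`, `J` there are versions `α`, `β` of the conditional probabilities of `x a ∈ I` and of
`x b ∈ J` whose product is one of the joint conditional probability. -/
def CondIndepCoords (μ : Measure (V → ℝ)) (a b : V) (S : Finset V) : Prop :=
  ∀ I J : Set ℝ, MeasurableSet I → MeasurableSet J →
    ∃ α β : (S → ℝ) → ℝ≥0∞, Measurable α ∧ Measurable β ∧ ∀ E : Set (S → ℝ), MeasurableSet E →
      μ {x | S.restrict x ∈ E ∧ x a ∈ I} = ∫⁻ z in E, α z ∂μ.map S.restrict ∧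
      μ {x | S.restrict x ∈ E ∧ x b ∈ J} = ∫⁻ z in E, β z ∂μ.map S.restrict ∧
      μ {x | S.restrict x ∈ E ∧ x a ∈ I ∧ x b ∈ J} = ∫⁻ z in E, α z * β z ∂μ.map S.restrict

theorem restrict_update_of_notMem [DecidableEq V] {S : Finset V} {a : V} (ha : a ∉ S)
    (x : V → ℝ) (t : ℝ) : S.restrict (Function.update x a t) = S.restrict x := by
  ext i
  have : i.1 ≠ a := fun h => ha (h ▸ i.2)
  simp [this]

variable [Fintype V]

theorem setLIntegral_map_restrict_of_withDensity {ν : V → Measure ℝ} {μ : Measure (V → ℝ)}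
    {h : (K : Finset V) → (K → ℝ) → ℝ≥0∞} (hh : ∀ K, Measurable (h K))
    (hμ : ∀ K : Finset V, μ.map K.restrict =
      ((Measure.pi ν).map K.restrict).withDensity (h K)) (K : Finset V)
    {φ : (K → ℝ) → ℝ≥0∞} (hφ : Measurable φ) {E : Set (K → ℝ)} (hE : MeasurableSet E) :
    ∫⁻ z in E, φ z ∂μ.map K.restrict =
      ∫⁻ z in E, φ z * h K z ∂(Measure.pi ν).map K.restrict := by
  rw [hμ K, restrict_withDensity hE, lintegral_withDensity_eq_lintegral_mul _ (hh K) hφ]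
  simp only [Pi.mul_apply, mul_comm]

variable [DecidableEq V]

/-- In an integral with respect to a product of probability measures, a factor may be replaced by
its integral over a coordinate that the other factor does not depend on. -/
theorem lintegral_pi_mul_lmarginal (ν : V → Measure ℝ) [∀ i, IsProbabilityMeasure (ν i)] (a : V)
    {f g : (V → ℝ) → ℝ≥0∞} (hf : Measurable f) (hg : Measurable g)
    (hga : ∀ x t, g (Function.update x a t) = g x) :
    ∫⁻ x, g x * f x ∂Measure.pi ν =
      ∫⁻ x, g x * ∫⁻ t, f (Function.update x a t) ∂ν a ∂Measure.pi ν := by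
  have hm : Measurable fun x => ∫⁻ t, f (Function.update x a t) ∂ν a := by
    have := hf.lmarginal ν (s := {a})
    rwa [lmarginal_singleton] at this
  have hfa : ∀ x, Measurable fun t => f (Function.update x a t) := fun x =>
    hf.comp (measurable_update x)
  refine lintegral_eq_of_lmarginal_eq {a} (hg.mul hf) (hg.mul hm) ?_
  ext x
  simp only [lmarginal_singleton, Function.update_idem, hga]
  rw [lintegral_const, measure_univ, mul_one, lintegral_const_mul _ (hfa x)]

variable {ν : V → Measure ℝ} [∀ i, IsProbabilityMeasure (ν i)] {μ : Measure (V → ℝ)}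
  {h : (K : Finset V) → (K → ℝ) → ℝ≥0∞}

/-- The integral of a marginal density over a slice. -/
theorem lintegral_slice_ae_eq (hh : ∀ K, Measurable (h K))
    (hμ : ∀ K : Finset V, μ.map K.restrict =
      ((Measure.pi ν).map K.restrict).withDensity (h K))
    {S A : Finset V} {a : V} (ha : a ∉ S) (hA : A = insert a S) {I : Set ℝ} (hI : MeasurableSet I)
    {α : (S → ℝ) → ℝ≥0∞} (hα : Measurable α)
    (hαE : ∀ E : Set (S → ℝ), MeasurableSet E →
      μ {x | S.restrict x ∈ E ∧ x a ∈ I} = ∫⁻ z in E, α z ∂μ.map S.restrict) :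
    ∃ m : (S → ℝ) → ℝ≥0∞, Measurable m ∧
      (∀ x : V → ℝ, ∫⁻ t, I.indicator 1 (Function.update x a t a) *
        h A (A.restrict (Function.update x a t)) ∂ν a = m (S.restrict x)) ∧
      m =ᵐ[(Measure.pi ν).map S.restrict] fun z => α z * h S z := by
  have haA : a ∈ A := hA ▸ Finset.mem_insert_self _ _
  have hSA : S ⊆ A := hA ▸ Finset.subset_insert _ _
  -- The only element of `A` outside `S` is `a`, so the default value `p.2` is the coordinate `a`.
  let ext' : (S → ℝ) × ℝ → A → ℝ := fun p i => if hi : i.1 ∈ S then p.1 ⟨i.1, hi⟩ else p.2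
  have hext : Measurable ext' := by
    refine measurable_pi_lambda _ fun i => ?_
    by_cases hi : i.1 ∈ S
    · simp only [ext', hi, dif_pos]; fun_prop
    · simp only [ext', hi, dite_false]; fun_prop
  have hind : Measurable (I.indicator (1 : ℝ → ℝ≥0∞)) := measurable_one.indicator hI
  let m : (S → ℝ) → ℝ≥0∞ := fun z => ∫⁻ t, I.indicator 1 t * h A (ext' (z, t)) ∂ν a
  have hm : Measurable m := by
    refine Measurable.lintegral_prod_right' (f := fun p : (S → ℝ) × ℝ =>
      I.indicator 1 p.2 * h A (ext' p)) ?_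
    exact (hind.comp measurable_snd).mul ((hh A).comp hext)
  have hmx : ∀ x : V → ℝ, ∫⁻ t, I.indicator 1 (Function.update x a t a) *
        h A (A.restrict (Function.update x a t)) ∂ν a = m (S.restrict x) := by
    intro x
    refine lintegral_congr fun t => ?_
    rw [Function.update_self]
    congr 2
    ext i
    have hi : i.1 = a ∨ i.1 ∈ S := Finset.mem_insert.1 (hA.subset i.2)
    by_cases hiS : i.1 ∈ S
    · have : i.1 ≠ a := fun h => ha (h ▸ hiS)
      simp [ext', hiS, Finset.restrict, this]
    · have : i.1 = a := hi.resolve_right hiS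
      simp [ext', Finset.restrict, this, ha]
  refine ⟨m, hm, hmx, ?_⟩
  have : SigmaFinite ((Measure.pi ν).map S.restrict) := by
    have := Measure.isProbabilityMeasure_map (μ := Measure.pi ν)
      (Finset.measurable_restrict S).aemeasurable
    infer_instance
  -- Over every `E`, both functions integrate to `μ {x | S.restrict x ∈ E ∧ x a ∈ I}`: one by the
  -- choice of `α`, the other by integrating the coordinate `a` out of `h A`.
  refine ae_eq_of_forall_setLIntegral_eq_of_sigmaFinite hm (hα.mul (hh S)) fun E hE _ => ?_
  rw [← setLIntegral_map_restrict_of_withDensity hh hμ S hα hE, ← hαE E hE,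
    setLIntegral_map hE hm (Finset.measurable_restrict S)]
  have hE' : MeasurableSet (S.restrict (π := fun _ => ℝ) ⁻¹' E) := Finset.measurable_restrict S hE
  let F : Set (A → ℝ) := {w | Finset.restrict₂ (π := fun _ => ℝ) hSA w ∈ E ∧ w ⟨a, haA⟩ ∈ I}
  have hF : MeasurableSet F :=
    (Finset.measurable_restrict₂ (X := fun _ => ℝ) hSA hE).inter
      (measurable_pi_apply (⟨a, haA⟩ : A) hI)
  have hAF : {x : V → ℝ | S.restrict x ∈ E ∧ x a ∈ I} = A.restrict ⁻¹' F := rfl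
  have hmarg := lintegral_pi_mul_lmarginal ν a
    (f := fun x => I.indicator 1 (x a) * h A (A.restrict x))
    (g := fun x => E.indicator 1 (S.restrict x))
    ((hind.comp (measurable_pi_apply a)).mul ((hh A).comp (Finset.measurable_restrict A)))
    ((measurable_one.indicator hE).comp (Finset.measurable_restrict S))
    (fun x t => by rw [restrict_update_of_notMem ha])
  simp only [hmx] at hmarg
  rw [hAF, ← Measure.map_apply (Finset.measurable_restrict A) hF, hμ A, withDensity_apply _ hF,
    setLIntegral_map hF (hh A) (Finset.measurable_restrict A), ← lintegral_indicator hE',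
    ← lintegral_indicator (Finset.measurable_restrict A hF)]
  refine Eq.trans (lintegral_congr fun x => ?_) (hmarg.symm.trans (lintegral_congr fun x => ?_))
  · by_cases hx : S.restrict x ∈ E <;> simp [Set.indicator, hx]
  · by_cases hx : S.restrict x ∈ E <;> by_cases hx' : x a ∈ I <;>
      simp [Set.indicator, hx, hx', F, ← hAF]

/-- Under conditional independence the density of `A ∪ B` factorizes. -/
theorem CondIndepCoords.density_union_ae_eq [IsFiniteMeasure μ] (hh : ∀ K, Measurable (h K))
    (hμ : ∀ K : Finset V, μ.map K.restrict =
      ((Measure.pi ν).map K.restrict).withDensity (h K))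
    {A B : Finset V} {a b : V} (ha : a ∉ B) (hb : b ∉ A) (hA : A = insert a (A ∩ B))
    (hB : B = insert b (A ∩ B)) (hci : CondIndepCoords μ a b (A ∩ B)) :
    ∀ᵐ x ∂Measure.pi ν, h (A ∪ B) ((A ∪ B).restrict x) =
      h A (A.restrict x) * h B (B.restrict x) / h (A ∩ B) ((A ∩ B).restrict x) := by
  have hprob : ∀ K : Finset V, IsProbabilityMeasure ((Measure.pi ν).map K.restrict) := fun K =>
    Measure.isProbabilityMeasure_map (Finset.measurable_restrict K).aemeasurable
  have hfin : ∀ K : Finset V, ∫⁻ z, h K z ∂(Measure.pi ν).map K.restrict ≠ ∞ := fun K => by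
    have := congrArg (fun ρ => ρ Set.univ) (hμ K)
    simp only [withDensity_apply _ MeasurableSet.univ, Measure.restrict_univ] at this
    rw [← this]
    exact measure_ne_top _ _
  have hr := fun K : Finset V => Finset.measurable_restrict (X := fun _ : V => ℝ) K
  set S := A ∩ B with hS
  set K := A ∪ B with hK
  have haS : a ∉ S := fun h => ha (Finset.inter_subset_right h)
  have hbS : b ∉ S := fun h => hb (Finset.inter_subset_left h)
  have hAK : A ⊆ K := Finset.subset_union_left
  have hBK : B ⊆ K := Finset.subset_union_right
  have hSK : S ⊆ K := Finset.inter_subset_left.trans hAK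
  have haK : a ∈ K := hAK (hA ▸ Finset.mem_insert_self _ _)
  have hbK : b ∈ K := hBK (hB ▸ Finset.mem_insert_self _ _)
  let r : (K → ℝ) → ℝ≥0∞ := fun w => h A (Finset.restrict₂ (π := fun _ => ℝ) hAK w) *
    h B (Finset.restrict₂ (π := fun _ => ℝ) hBK w) / h S (Finset.restrict₂ (π := fun _ => ℝ) hSK w)
  have hrm : Measurable r :=
    (((hh A).comp (Finset.measurable_restrict₂ hAK)).mul
      ((hh B).comp (Finset.measurable_restrict₂ hBK))).div
      ((hh S).comp (Finset.measurable_restrict₂ hSK))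
  -- Boxes form a generating π-system, so it suffices that `r` integrates over each box to the right
  -- mass. A box in `K` is given by a box `E` in `S` and the sides `I`, `J` at `a`, `b`.
  have hbox : ∀ s : K → Set ℝ, (∀ i, MeasurableSet (s i)) →
      μ.map K.restrict (Set.univ.pi s) =
        ((Measure.pi ν).map K.restrict).withDensity r (Set.univ.pi s) := by
    intro s hs
    let E : Set (S → ℝ) := Set.univ.pi fun i => s ⟨i, hSK i.2⟩
    have hE : MeasurableSet E := MeasurableSet.univ_pi fun i => hs _
    let I := s ⟨a, haK⟩
    let J := s ⟨b, hbK⟩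
    obtain ⟨α, β, hα, hβ, hαβ⟩ := hci I J (hs _) (hs _)
    obtain ⟨m, hm, hmx, hmα⟩ := lintegral_slice_ae_eq hh hμ haS hA (I := I) (hs _) hα
      fun E hE => (hαβ E hE).1
    obtain ⟨n, hn, hnx, hnβ⟩ := lintegral_slice_ae_eq hh hμ hbS hB (I := J) (hs _) hβ
      fun E hE => (hαβ E hE).2.1
    have hIm : Measurable (I.indicator (1 : ℝ → ℝ≥0∞)) := measurable_one.indicator (hs _)
    have hJm : Measurable (J.indicator (1 : ℝ → ℝ≥0∞)) := measurable_one.indicator (hs _)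
    have hEm : Measurable (E.indicator (1 : (S → ℝ) → ℝ≥0∞)) := measurable_one.indicator hE
    have hpre : K.restrict ⁻¹' Set.univ.pi s =
        {x : V → ℝ | S.restrict x ∈ E ∧ x a ∈ I ∧ x b ∈ J} := by
      ext x
      simp only [Set.mem_preimage, Set.mem_univ_pi, Set.mem_ofPred_eq, E, I, J]
      constructor
      · exact fun hx => ⟨fun i => hx ⟨i, hSK i.2⟩, hx ⟨a, haK⟩, hx ⟨b, hbK⟩⟩
      · rintro ⟨h1, h2, h3⟩ ⟨i, hi⟩
        by_cases hiS : i ∈ S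
        · exact h1 ⟨i, hiS⟩
        · rcases Finset.mem_union.1 hi with hiA | hiB
          · rw [hA, Finset.mem_insert, or_iff_left hiS] at hiA
            subst hiA; exact h2
          · rw [hB, Finset.mem_insert, or_iff_left hiS] at hiB
            subst hiB; exact h3
    have hsm : MeasurableSet (Set.univ.pi s) := MeasurableSet.univ_pi hs
    rw [Measure.map_apply (hr K) hsm, hpre, (hαβ E hE).2.2,
      setLIntegral_map_restrict_of_withDensity hh hμ S
        (φ := fun z => α z * β z) (hα.mul hβ) hE,
      withDensity_apply _ hsm, setLIntegral_map hsm hrm (hr K), ← lintegral_indicator (hr K hsm),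
      hpre]
    -- Integrating out first `a` and then `b` turns the integral of `r` over the box into that of `m
    -- n / h_S` over `E`. With `m = α h_S` and `n = β h_S` this is the integral of `α β h_S`.
    have hma := lintegral_pi_mul_lmarginal ν a
      (f := fun x => I.indicator 1 (x a) * h A (A.restrict x))
      (g := fun x => E.indicator 1 (S.restrict x) * (h S (S.restrict x))⁻¹ *
        (J.indicator 1 (x b) * h B (B.restrict x)))
      ((hIm.comp (measurable_pi_apply a)).mul ((hh A).comp (hr A)))
      (((hEm.comp (hr S)).mul ((hh S).comp (hr S)).inv).mul
        ((hJm.comp (measurable_pi_apply b)).mul ((hh B).comp (hr B))))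
      (fun x t => by
        have hba : b ≠ a := fun h => hbS.elim (by
          subst h; exact absurd (hA ▸ Finset.mem_insert_self _ _) hb)
        simp only [restrict_update_of_notMem haS, restrict_update_of_notMem ha,
          Function.update_of_ne hba])
    have hmb := lintegral_pi_mul_lmarginal ν b
      (f := fun x => J.indicator 1 (x b) * h B (B.restrict x))
      (g := fun x => E.indicator 1 (S.restrict x) * (h S (S.restrict x))⁻¹ * m (S.restrict x))
      ((hJm.comp (measurable_pi_apply b)).mul ((hh B).comp (hr B)))
      (((hEm.comp (hr S)).mul ((hh S).comp (hr S)).inv).mul (hm.comp (hr S)))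
      (fun x t => by simp only [restrict_update_of_notMem hbS])
    simp only [hmx] at hma
    simp only [hnx] at hmb
    have hmid : ∀ x : V → ℝ,
        E.indicator 1 (S.restrict x) * (h S (S.restrict x))⁻¹ *
          (J.indicator 1 (x b) * h B (B.restrict x)) * m (S.restrict x) =
        E.indicator 1 (S.restrict x) * (h S (S.restrict x))⁻¹ * m (S.restrict x) *
          (J.indicator 1 (x b) * h B (B.restrict x)) := fun x => by ring
    simp only [hmid] at hma
    rw [hmb] at hma
    have hleft : ∀ x : V → ℝ,
        {x : V → ℝ | S.restrict x ∈ E ∧ x a ∈ I ∧ x b ∈ J}.indicator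
          (fun x => r (K.restrict x)) x =
        E.indicator 1 (S.restrict x) * (h S (S.restrict x))⁻¹ *
          (J.indicator 1 (x b) * h B (B.restrict x)) *
          (I.indicator 1 (x a) * h A (A.restrict x)) := by
      intro x
      have hrx : r (K.restrict x) =
          h A (A.restrict x) * h B (B.restrict x) / h S (S.restrict x) := rfl
      by_cases h1 : S.restrict x ∈ E <;> by_cases h2 : x a ∈ I <;> by_cases h3 : x b ∈ J <;>
        simp [Set.indicator, h1, h2, h3, hrx, div_eq_mul_inv]
      ring
    rw [lintegral_congr hleft, hma, ← lintegral_indicator hE]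
    have hSfin := ae_lt_top (hh S) (hfin S)
    rw [← lintegral_map (f := fun z => E.indicator 1 z * (h S z)⁻¹ * m z * n z)
      (((hEm.mul (hh S).inv).mul hm).mul hn) (hr S)]
    refine lintegral_congr_ae ?_
    filter_upwards [hmα, hnβ, hSfin] with z h1 h2 h3
    by_cases hz : z ∈ E
    · simp only [Set.indicator_of_mem hz, h1, h2, Pi.one_apply, one_mul]
      -- Where `h_S = 0` its inverse is `∞`, but it is multiplied by `0`, and both sides vanish.
      rcases eq_or_ne (h S z) 0 with h0 | h0
      · simp [h0]
      · calc α z * β z * h S z = ((h S z)⁻¹ * h S z) * (α z * β z * h S z) := by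
              rw [ENNReal.inv_mul_cancel h0 h3.ne, one_mul]
          _ = _ := by ring
    · simp [hz]
  have hmeas : μ.map K.restrict = ((Measure.pi ν).map K.restrict).withDensity r := by
    refine ext_of_generate_finite _ generateFrom_pi.symm isPiSystem_pi ?_ ?_
    · rintro _ ⟨s, hs, rfl⟩
      exact hbox s fun i => hs i (Set.mem_univ i)
    · simpa using hbox (fun _ => Set.univ) fun _ => MeasurableSet.univ
  rw [hμ K, withDensity_eq_iff (hh K).aemeasurable hrm.aemeasurable (hfin K)] at hmeas
  exact ae_of_ae_map (hr K).aemeasurable hmeas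

end

/-! ### Distribution functions, quantile functions and copulas -/

/-- Probability measures on `ι → ℝ` with the same distribution function are equal. -/
theorem measure_pi_ext_of_Iic {ι : Type*} [Finite ι] {μ ν : Measure (ι → ℝ)}
    [IsProbabilityMeasure μ] [IsProbabilityMeasure ν]
    (h : ∀ x : ι → ℝ, μ (Set.Iic x) = ν (Set.Iic x)) : μ = ν := by
  have hspan : IsCountablySpanning (Set.range (Set.Iic : ℝ → Set ℝ)) := by
    refine ⟨fun n : ℕ => Set.Iic (n : ℝ), fun n => ⟨n, rfl⟩, Set.eq_univ_of_forall fun x => ?_⟩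
    obtain ⟨n, hn⟩ := exists_nat_ge x
    exact Set.mem_iUnion.2 ⟨n, hn⟩
  have hgen : MeasurableSpace.generateFrom (Set.range (Set.Iic : ℝ → Set ℝ)) =
      (inferInstance : MeasurableSpace ℝ) := by
    rw [← borel_eq_generateFrom_Iic, BorelSpace.measurable_eq (α := ℝ)]
  refine ext_of_generate_finite _ (generateFrom_eq_pi (fun _ : ι => hgen) fun _ => hspan).symm
    (IsPiSystem.pi fun _ => isPiSystem_Iic) ?_ (by simp)
  rintro _ ⟨s, hs, rfl⟩
  choose x hx using fun i => hs i (Set.mem_univ i)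
  have : Set.univ.pi s = Set.Iic x := by
    rw [← Set.pi_univ_Iic]
    exact congrArg _ (funext fun i => (hx i).symm)
  rw [this, h x]

/-- The quantile function of a distribution on the real line, set to `0` outside `(0, 1)`. -/
noncomputable def quantile (μ : Measure ℝ) (u : ℝ) : ℝ :=
  open Classical in if u ∈ Set.Ioo (0 : ℝ) 1 then sInf {x | u ≤ cdf μ x} else 0

section Quantile

variable (μ : Measure ℝ)

/-- For `0 < u < 1` the limits at `±∞` make the infimum one of a nonempty set bounded below;
right-continuity makes it attained. -/
theorem quantile_le_iff {u : ℝ} (hu : u ∈ Set.Ioo (0 : ℝ) 1) (x : ℝ) :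
    quantile μ u ≤ x ↔ u ≤ cdf μ x := by
  rw [quantile, if_pos hu]
  have hbdd : BddBelow {x | u ≤ cdf μ x} := by
    obtain ⟨y, hy⟩ := ((tendsto_cdf_atBot μ).eventually (gt_mem_nhds hu.1)).exists
    exact ⟨y, fun z hz => le_of_not_gt fun hzy =>
      absurd (hz.trans (monotone_cdf μ hzy.le)) (not_le.2 hy)⟩
  have hne : {x | u ≤ cdf μ x}.Nonempty := by
    obtain ⟨y, hy⟩ := ((tendsto_cdf_atTop μ).eventually (lt_mem_nhds hu.2)).exists
    exact ⟨y, hy.le⟩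
  constructor
  · intro hx
    have hmono : ∀ y > x, u ≤ cdf μ y := fun y hy => by
      obtain ⟨z, hz, hzy⟩ := exists_lt_of_csInf_lt hne (hx.trans_lt hy)
      exact hz.trans (monotone_cdf μ hzy.le)
    have ht : Filter.Tendsto (cdf μ) (nhdsWithin x (Set.Ioi x)) (nhds (cdf μ x)) :=
      ((cdf μ).right_continuous x).mono_left (nhdsWithin_mono _ Set.Ioi_subset_Ici_self)
    exact ge_of_tendsto ht (Filter.eventually_of_mem self_mem_nhdsWithin hmono)
  · exact fun hx => csInf_le hbdd hx

theorem measurable_quantile : Measurable (quantile μ) := by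
  refine measurable_of_Iic fun x => ?_
  have : quantile μ ⁻¹' Set.Iic x =
      (Set.Ioo 0 1 ∩ Set.Iic (cdf μ x)) ∪ ((Set.Ioo 0 1)ᶜ ∩ {_u | 0 ≤ x}) := by
    ext u
    by_cases hu : u ∈ Set.Ioo (0 : ℝ) 1
    · simp only [Set.mem_preimage, Set.mem_Iic, quantile_le_iff μ hu, Set.mem_union,
        Set.mem_inter_iff, hu, Set.mem_compl_iff]
      simp
    · have h0 : quantile μ u = 0 := by rw [quantile, if_neg hu]
      simp only [Set.mem_preimage, Set.mem_Iic, h0, Set.mem_union, Set.mem_inter_iff, hu,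
        Set.mem_compl_iff]
      simp
  rw [this]
  exact (measurableSet_Ioo.inter measurableSet_Iic).union
    (measurableSet_Ioo.compl.inter (MeasurableSet.const _))

theorem measurable_cdf_coe : Measurable (cdf μ) := (monotone_cdf μ).measurable

theorem cdf_quantile [IsProbabilityMeasure μ] (hμ : μ ≪ volume) {u : ℝ}
    (hu : u ∈ Set.Ioo (0 : ℝ) 1) : cdf μ (quantile μ u) = u := by
  refine le_antisymm ?_ ((quantile_le_iff μ hu _).1 le_rfl)
  -- There is no atom at the quantile, so the value there is at most the left limit, and to the left
  -- of the quantile the distribution function stays below `u`.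
  have hsing : (cdf μ).measure {quantile μ u} = 0 := by
    rw [measure_cdf]
    exact hμ Real.volume_singleton
  rw [StieltjesFunction.measure_singleton, ENNReal.ofReal_eq_zero, sub_nonpos] at hsing
  refine hsing.trans ?_
  have ht := (monotone_cdf μ).tendsto_leftLim (quantile μ u)
  refine le_of_tendsto ht (Filter.eventually_of_mem self_mem_nhdsWithin fun y hy => ?_)
  by_contra hlt
  exact absurd ((quantile_le_iff μ hu y).2 (not_le.1 hlt).le) (not_le.2 hy)

end Quantile

/-! ### Absolute continuity with respect to product measures -/

theorem pi_absolutelyContinuous_pi {ι : Type*} [Fintype ι] {μ ν : ι → Measure ℝ}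
    [∀ i, SigmaFinite (μ i)] [∀ i, IsProbabilityMeasure (ν i)] (h : ∀ i, μ i ≪ ν i) :
    Measure.pi μ ≪ Measure.pi ν := by
  let g : ι → ℝ → ℝ≥0∞ := fun i => (μ i).rnDeriv (ν i)
  have hg : ∀ i, Measurable (g i) := fun i => Measure.measurable_rnDeriv _ _
  have heq : Measure.pi μ = (Measure.pi ν).withDensity fun x => ∏ i, g i (x i) := by
    refine Measure.pi_eq fun s hs => ?_
    rw [withDensity_apply _ (MeasurableSet.univ_pi hs),
      ← lintegral_indicator (MeasurableSet.univ_pi hs)]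
    have hind : ∀ i, Measurable ((s i).indicator (g i)) := fun i => (hg i).indicator (hs i)
    have h1 : ∀ x : ι → ℝ, (Set.univ.pi s).indicator (fun x => ∏ i, g i (x i)) x =
        ∏ i, (s i).indicator (g i) (x i) := by
      intro x
      by_cases hx : x ∈ Set.univ.pi s
      · rw [Set.indicator_of_mem hx]
        exact Finset.prod_congr rfl fun i _ => (Set.indicator_of_mem (hx i trivial) _).symm
      · rw [Set.indicator_of_notMem hx]
        obtain ⟨i, hi⟩ : ∃ i, x i ∉ s i := by simpa [Set.mem_univ_pi] using hx
        exact (Finset.prod_eq_zero (Finset.mem_univ i) (Set.indicator_of_notMem hi _)).symm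
    rw [lintegral_congr h1, lintegral_prod_eq_prod_lintegral_of_indepFun Finset.univ
      (fun i (x : ι → ℝ) => (s i).indicator (g i) (x i))
      (iIndepFun_pi (X := fun i => (s i).indicator (g i)) fun i => (hind i).aemeasurable)
      (fun i => (hind i).comp (measurable_pi_apply i))]
    refine Finset.prod_congr rfl fun i _ => ?_
    rw [(measurePreserving_eval ν i).lintegral_comp (hind i), lintegral_indicator (hs i),
      ← withDensity_apply _ (hs i), Measure.withDensity_rnDeriv_eq _ _ (h i)]
  rw [heq]
  exact withDensity_absolutelyContinuous _ _

theorem absolutelyContinuous_map_eval {ι : Type*} [Fintype ι] {P : Measure (ι → ℝ)}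
    (hP : P ≪ volume) (i : ι) :
    (P.map fun x => x i) ≪ volume :=
  (hP.map (measurable_pi_apply i)).trans
    (Measure.quasiMeasurePreserving_eval (fun _ => volume) i).2

/-- A distribution with a density is absolutely continuous with respect to the product of its
one-dimensional marginals. -/
theorem absolutelyContinuous_pi_map_eval {ι : Type*} [Fintype ι] {P : Measure (ι → ℝ)}
    [IsProbabilityMeasure P] (hP : P ≪ volume) :
    P ≪ Measure.pi fun i => P.map fun x => x i := by
  have hm : ∀ i, Measurable fun x : ι → ℝ => x i := fun i => measurable_pi_apply i
  have hprob : ∀ i, IsProbabilityMeasure (P.map fun x => x i) := fun i =>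
    Measure.isProbabilityMeasure_map (hm i).aemeasurable
  let f : ι → ℝ → ℝ≥0∞ := fun i => (P.map fun x => x i).rnDeriv volume
  have hf : ∀ i, Measurable (f i) := fun i => Measure.measurable_rnDeriv _ _
  have hfd : ∀ i, (P.map fun x => x i) = volume.withDensity (f i) := fun i =>
    (Measure.withDensity_rnDeriv_eq _ _ (absolutelyContinuous_map_eval hP i)).symm
  -- `P` is concentrated on the box where all marginal densities are positive, and on this box
  -- Lebesgue measure is absolutely continuous with respect to the product of the marginals.
  let Z : ι → Set ℝ := fun i => {t | f i t ≠ 0}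
  have hZ : ∀ i, MeasurableSet (Z i) := fun i =>
    (measurableSet_singleton (0 : ℝ≥0∞)).compl.preimage (hf i)
  have hPZ : ∀ᵐ x ∂P, x ∈ Set.univ.pi Z := by
    simp only [Set.mem_univ_pi]
    refine ae_all_iff.2 fun i => ?_
    refine ae_of_ae_map (hm i).aemeasurable (p := fun t => t ∈ Z i) ?_
    rw [hfd i, ae_withDensity_iff (hf i)]
    exact Filter.Eventually.of_forall fun t ht => ht
  have hbox : volume.restrict (Set.univ.pi Z) ≪ Measure.pi fun i => P.map fun x => x i := by
    rw [volume_pi, Measure.restrict_pi_pi]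
    refine pi_absolutelyContinuous_pi fun i => ?_
    have h1 : volume.restrict (Z i) ≪ (volume.restrict (Z i)).withDensity (f i) :=
      withDensity_absolutelyContinuous' (hf i).aemeasurable
        ((ae_restrict_iff' (hZ i)).2 (Filter.Eventually.of_forall fun t ht => ht))
    rw [← restrict_withDensity (hZ i), ← hfd i] at h1
    exact h1.trans Measure.restrict_le_self.absolutelyContinuous
  refine fun N hN => ?_
  have h2 := hbox hN
  rw [Measure.restrict_apply' (MeasurableSet.univ_pi hZ)] at h2
  have h3 := hP h2
  rw [Set.inter_comm, Measure.measure_inter_eq_of_ae hPZ] at h3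
  exact h3

/-! ### Passage between a distribution and its copula -/

section Copula

variable {ι : Type*} [Fintype ι] {C P : Measure (ι → ℝ)} [IsProbabilityMeasure P]

theorem IsCopula.ae_mem_Ioo (hC : IsCopula C) : ∀ᵐ u ∂C, ∀ i, u i ∈ Set.Ioo (0 : ℝ) 1 := by
  refine ae_all_iff.2 fun i => ?_
  refine ae_of_ae_map (f := fun u : ι → ℝ => u i)
    (measurable_pi_apply i).aemeasurable (p := fun t : ℝ => t ∈ Set.Ioo (0 : ℝ) 1) ?_
  rw [hC.2 i, ← Measure.restrict_congr_set Ioo_ae_eq_Icc]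
  exact ae_restrict_mem measurableSet_Ioo

/-- On the open cube, `quantile (u i) ≤ x i` means `u i ≤ F_i (x i)`, so the two distribution
functions agree by Sklar's identity. -/
theorem IsCopulaOf.map_quantile (h : IsCopulaOf C P) :
    C.map (fun u i => quantile (P.map fun x => x i) (u i)) = P := by
  have := h.1.1
  have hm : Measurable fun (u : ι → ℝ) i => quantile (P.map fun x => x i) (u i) :=
    measurable_pi_lambda _ fun i => (measurable_quantile _).comp (measurable_pi_apply i)
  have := Measure.isProbabilityMeasure_map (μ := C) hm.aemeasurable
  refine measure_pi_ext_of_Iic fun x => ?_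
  rw [Measure.map_apply hm measurableSet_Iic, h.2 x]
  refine measure_congr ?_
  filter_upwards [h.1.ae_mem_Ioo] with u hu
  refine propext ?_
  exact forall_congr' fun i => quantile_le_iff _ (hu i) _

theorem IsCopulaOf.ae_cdf_quantile (h : IsCopulaOf C P) (hP : P ≪ volume) :
    ∀ᵐ u ∂C, ∀ i, cdf (P.map fun x => x i) (quantile (P.map fun x => x i) (u i)) = u i := by
  filter_upwards [h.1.ae_mem_Ioo] with u hu i
  have := Measure.isProbabilityMeasure_map (μ := P) (measurable_pi_apply i).aemeasurable
  exact cdf_quantile _ (absolutelyContinuous_map_eval hP i) (hu i)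

/-- The copula of a distribution with a density is the image under the distribution functions of
the marginals. -/
theorem IsCopulaOf.map_cdf (h : IsCopulaOf C P) (hP : P ≪ volume) :
    P.map (fun x i => cdf (P.map fun x => x i) (x i)) = C := by
  have hm : Measurable fun (u : ι → ℝ) i => quantile (P.map fun x => x i) (u i) :=
    measurable_pi_lambda _ fun i => (measurable_quantile _).comp (measurable_pi_apply i)
  have hm' : Measurable fun (x : ι → ℝ) i => cdf (P.map fun x => x i) (x i) :=
    measurable_pi_lambda _ fun i => (measurable_cdf_coe _).comp (measurable_pi_apply i)
  have hcomp := Measure.map_map (μ := C) hm' hm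
  rw [h.map_quantile] at hcomp
  rw [hcomp]
  conv_rhs => rw [← Measure.map_id (μ := C)]
  refine Measure.map_congr ?_
  filter_upwards [h.ae_cdf_quantile hP] with u hu
  exact funext hu

/-- `P` is absolutely continuous with respect to the product of its marginals, and the marginal
distribution functions carry `P` to `C` and this product to the uniform distribution. -/
theorem IsCopulaOf.absolutelyContinuous (h : IsCopulaOf C P) (hP : P ≪ volume) :
    C ≪ Measure.pi fun _ => volume.restrict (Set.Icc 0 1) := by
  have hprob : ∀ i, IsProbabilityMeasure (P.map fun x => x i) := fun i =>
    Measure.isProbabilityMeasure_map (measurable_pi_apply i).aemeasurable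
  have hm' : ∀ i, Measurable fun x : ι → ℝ => cdf (P.map fun x => x i) (x i) := fun i =>
    (measurable_cdf_coe _).comp (measurable_pi_apply i)
  have hmarg : ∀ i, (P.map fun x => x i).map (cdf (P.map fun x => x i)) =
      volume.restrict (Set.Icc 0 1) := fun i => by
    rw [← h.1.2 i, Measure.map_map (measurable_cdf_coe _) (measurable_pi_apply i)]
    conv_rhs => rw [← h.map_cdf hP]
    rw [Measure.map_map (measurable_pi_apply i) (measurable_pi_lambda _ hm')]
    rfl
  have hac := (absolutelyContinuous_pi_map_eval hP).map (measurable_pi_lambda _ hm')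
  rw [h.map_cdf hP, Measure.pi_map_pi fun i => (measurable_cdf_coe _).aemeasurable] at hac
  simpa only [hmarg] using hac

end Copula

/-! ### From independent pair copulas to the factorization of the copula density -/

instance isProbabilityMeasure_uniform :
    IsProbabilityMeasure (volume.restrict (Set.Icc (0 : ℝ) 1)) := ⟨by simp⟩

/-- A distribution whose copula is the independence copula is the product of its marginals. -/
theorem IsCopulaOf.eq_pi {ι : Type*} [Fintype ι] {Q : Measure (ι → ℝ)} [IsProbabilityMeasure Q]
    (h : IsCopulaOf (independenceCopula ι) Q) : Q = Measure.pi fun i => Q.map fun y => y i := by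
  have hprob : ∀ i, IsProbabilityMeasure (Q.map fun x => x i) := fun i =>
    Measure.isProbabilityMeasure_map (measurable_pi_apply i).aemeasurable
  refine measure_pi_ext_of_Iic fun x => ?_
  rw [h.2 x, independenceCopula, ← Set.pi_univ_Iic, ← Set.pi_univ_Iic, Measure.pi_pi,
    Measure.pi_pi]
  refine Finset.prod_congr rfl fun i _ => ?_
  have hinter : Set.Iic (cdf (Q.map fun y => y i) (x i)) ∩ Set.Icc 0 1 =
      Set.Icc 0 (cdf (Q.map fun y => y i) (x i)) := by
    ext t
    have := cdf_le_one (Q.map fun y => y i) (x i)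
    simp only [Set.mem_inter_iff, Set.mem_Iic, Set.mem_Icc]
    constructor
    · rintro ⟨h1, h2, -⟩; exact ⟨h2, h1⟩
    · rintro ⟨h1, h2⟩; exact ⟨h2, h1, h2.trans this⟩
  rw [Measure.restrict_apply measurableSet_Iic, hinter, Real.volume_Icc, sub_zero, ofReal_cdf]

theorem IsCopulaOf.apply_and {Q : Measure (Fin 2 → ℝ)} [IsProbabilityMeasure Q]
    (h : IsCopulaOf (independenceCopula (Fin 2)) Q) {I J : Set ℝ} (hI : MeasurableSet I)
    (hJ : MeasurableSet J) :
    Q {y | y 0 ∈ I ∧ y 1 ∈ J} = Q {y | y 0 ∈ I} * Q {y | y 1 ∈ J} := by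
  have hprob : ∀ i, IsProbabilityMeasure (Q.map fun x => x i) := fun i =>
    Measure.isProbabilityMeasure_map (measurable_pi_apply i).aemeasurable
  have hset : {y : Fin 2 → ℝ | y 0 ∈ I ∧ y 1 ∈ J} = Set.univ.pi ![I, J] := by
    ext y
    simp [Fin.forall_fin_two]
  have hQ : Q (Set.univ.pi ![I, J]) =
      (Measure.pi fun i => Q.map fun y => y i) (Set.univ.pi ![I, J]) := by rw [← h.eq_pi]
  rw [hset, hQ, Measure.pi_pi, Fin.prod_univ_two]
  simp only [Matrix.cons_val_zero, Matrix.cons_val_one]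
  rw [Measure.map_apply (measurable_pi_apply 0) hI, Measure.map_apply (measurable_pi_apply 1) hJ]
  rfl

/-- Coordinates whose conditional copula is the independence copula are conditionally
independent. -/
theorem condIndepCoords_of_condPairLaw {d : ℕ} {P : Measure (Fin d → ℝ)} [IsProbabilityMeasure P]
    {a b : Fin d} {S : Finset (Fin d)}
    (h : ∀ᵐ z ∂P.map S.restrict,
      IsCopulaOf (independenceCopula (Fin 2)) (condPairLaw P a b S z)) :
    CondIndepCoords P a b S := by
  intro I J hI hJ
  have hX : Measurable (S.restrict (π := fun _ => ℝ)) := Finset.measurable_restrict S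
  have hY : Measurable fun x : Fin d → ℝ => ![x a, x b] := by
    refine measurable_pi_lambda _ fun i => ?_
    fin_cases i
    · exact measurable_pi_apply a
    · exact measurable_pi_apply b
  have hI' : MeasurableSet {y : Fin 2 → ℝ | y 0 ∈ I} := measurable_pi_apply 0 hI
  have hJ' : MeasurableSet {y : Fin 2 → ℝ | y 1 ∈ J} := measurable_pi_apply 1 hJ
  have key : ∀ s : Set (Fin 2 → ℝ), MeasurableSet s → ∀ E : Set (S → ℝ), MeasurableSet E →
      P {x | S.restrict x ∈ E ∧ ![x a, x b] ∈ s} =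
        ∫⁻ z in E, condPairLaw P a b S z s ∂P.map S.restrict := by
    intro s hs E hE
    rw [setLIntegral_map hE (Kernel.measurable_coe _ hs) hX, condPairLaw,
      setLIntegral_preimage_condDistrib hX hY.aemeasurable hs hE]
    rfl
  refine ⟨fun z => condPairLaw P a b S z {y | y 0 ∈ I},
    fun z => condPairLaw P a b S z {y | y 1 ∈ J},
    Kernel.measurable_coe _ hI', Kernel.measurable_coe _ hJ', fun E hE =>
    ⟨key _ hI' E hE, key _ hJ' E hE, (key _ (hI'.inter hJ') E hE).trans ?_⟩⟩
  refine lintegral_congr_ae (ae_restrict_of_ae ?_)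
  filter_upwards [h] with z hz
  have : IsProbabilityMeasure (condPairLaw P a b S z) := by
    unfold condPairLaw; infer_instance
  exact hz.apply_and hI hJ

/-- Conditional independence of coordinates is inherited by the copula. -/
theorem CondIndepCoords.copula {V : Type*} [Fintype V] {C P : Measure (V → ℝ)}
    [IsProbabilityMeasure P] (h : IsCopulaOf C P) (hP : P ≪ volume) {a b : V} {S : Finset V}
    (hci : CondIndepCoords P a b S) : CondIndepCoords C a b S := by
  intro I J hI hJ
  let F : V → ℝ → ℝ := fun i => cdf (P.map fun x => x i)
  let G : V → ℝ → ℝ := fun i => quantile (P.map fun x => x i)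
  have hF : ∀ i, Measurable (F i) := fun i => measurable_cdf_coe _
  have hG : ∀ i, Measurable (G i) := fun i => measurable_quantile _
  have hFS : Measurable fun (z : S → ℝ) (i : S) => F i (z i) :=
    measurable_pi_lambda _ fun i => (hF i).comp (measurable_pi_apply i)
  have hGS : Measurable fun (z : S → ℝ) (i : S) => G i (z i) :=
    measurable_pi_lambda _ fun i => (hG i).comp (measurable_pi_apply i)
  have hGV : Measurable fun (u : V → ℝ) i => G i (u i) :=
    measurable_pi_lambda _ fun i => (hG i).comp (measurable_pi_apply i)
  have hr : Measurable (S.restrict (π := fun _ => ℝ)) := Finset.measurable_restrict S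
  have hFG : ∀ᵐ u ∂C, ∀ i, F i (G i (u i)) = u i := h.ae_cdf_quantile hP
  have hCP : C.map (fun u i => G i (u i)) = P := h.map_quantile
  have happly : ∀ N : Set (V → ℝ), MeasurableSet N → P N = C {u | (fun i => G i (u i)) ∈ N} :=
    fun N hN => by rw [← hCP, Measure.map_apply hGV hN]; rfl
  -- Since `F_i (G_i (u i)) = u i` almost surely, `u a ∈ I` is the event that `G_a (u a)` lies in
  -- the preimage of `I` under `F_a`. Conditional probabilities for `P`, composed with the quantile
  -- functions, thus serve for `C`.
  obtain ⟨α, β, hα, hβ, hαβ⟩ := hci (F a ⁻¹' I) (F b ⁻¹' J) (hF a hI) (hF b hJ)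
  refine ⟨fun z => α fun i => G i (z i), fun z => β fun i => G i (z i), hα.comp hGS, hβ.comp hGS,
    fun E hE => ?_⟩
  let E' : Set (S → ℝ) := (fun (z : S → ℝ) (i : S) => F i (z i)) ⁻¹' E
  have hE' : MeasurableSet E' := hFS hE
  have hEF : ∀ u : V → ℝ, (∀ i, F i (G i (u i)) = u i) →
      ((S.restrict fun i => G i (u i)) ∈ E' ↔ S.restrict u ∈ E) := by
    intro u hu
    have : (fun i : S => F i (S.restrict (fun i => G i (u i)) i)) = S.restrict u :=
      funext fun i => hu i
    simp only [E', Set.mem_preimage, this]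
  have hint : ∀ φ : (S → ℝ) → ℝ≥0∞, Measurable φ →
      ∫⁻ z in E', φ z ∂P.map S.restrict =
        ∫⁻ z in E, φ (fun i => G i (z i)) ∂C.map S.restrict := by
    intro φ hφ
    have hind : Measurable fun x : V → ℝ => φ (S.restrict x) := hφ.comp hr
    rw [setLIntegral_map hE' hφ hr, setLIntegral_map hE
      (f := fun z => φ fun i => G i (z i)) (hφ.comp hGS) hr, ← hCP,
      setLIntegral_map (hr hE') hind hGV]
    refine setLIntegral_congr ?_
    filter_upwards [hFG] with u hu
    exact propext (hEF u hu)
  obtain ⟨h1, h2, h3⟩ := hαβ E' hE'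
  have hmI : MeasurableSet {x : V → ℝ | x a ∈ F a ⁻¹' I} := measurable_pi_apply a (hF a hI)
  have hmJ : MeasurableSet {x : V → ℝ | x b ∈ F b ⁻¹' J} := measurable_pi_apply b (hF b hJ)
  rw [← hint α hα, ← hint β hβ, ← hint (fun z => α z * β z) (hα.mul hβ), ← h1, ← h2, ← h3]
  refine ⟨(measure_congr ?_).trans (happly _ ((hr hE').inter hmI)).symm,
    (measure_congr ?_).trans (happly _ ((hr hE').inter hmJ)).symm,
    (measure_congr ?_).trans (happly _ ((hr hE').inter (hmI.inter hmJ))).symm⟩ <;>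
    filter_upwards [hFG] with u hu <;> refine propext ?_
  · exact (and_congr (hEF u hu) (by simp [hu a])).symm
  · exact (and_congr (hEF u hu) (by simp [hu b])).symm
  · exact (and_congr (hEF u hu) (by simp [hu a, hu b])).symm

/-! ### Marginal densities of a copula and the product formula -/

section Density

variable {V : Type*} [Fintype V] {C : Measure (V → ℝ)}

theorem map_restrict_pi_uniform (K : Finset V) :
    (Measure.pi fun _ : V => volume.restrict (Set.Icc (0 : ℝ) 1)).map K.restrict =
      volume.restrict (Set.univ.pi fun _ : K => Set.Icc (0 : ℝ) 1) := by
  rw [← Measure.infinitePi_eq_pi, Measure.infinitePi_map_restrict, volume_pi,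
    Measure.restrict_pi_pi]

theorem measurable_marginalDensity {V : Type*} {C : Measure (V → ℝ)} (K : Finset V) :
    Measurable (marginalDensity C K) :=
  Measure.measurable_rnDeriv _ _

theorem quasiMeasurePreserving_restrict [DecidableEq V] (K : Finset V) :
    Measure.QuasiMeasurePreserving (K.restrict (π := fun _ => ℝ)) volume volume := by
  have h := Measure.quasiMeasurePreserving_fst.comp
    (measurePreserving_piEquivPiSubtypeProd (fun _ : V => (volume : Measure ℝ))
      (· ∈ K)).quasiMeasurePreserving
  rw [volume_pi, volume_pi]
  convert h <;> rfl

theorem map_restrict_eq_withDensity [IsFiniteMeasure C]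
    (hC : C ≪ Measure.pi fun _ : V => volume.restrict (Set.Icc (0 : ℝ) 1))
    (K : Finset V) :
    C.map K.restrict = volume.withDensity (marginalDensity C K) := by
  have hac := hC.map (Finset.measurable_restrict K)
  rw [map_restrict_pi_uniform] at hac
  exact (Measure.withDensity_rnDeriv_eq _ _
    (hac.trans Measure.restrict_le_self.absolutelyContinuous)).symm

theorem ae_map_restrict_mem_cube
    (hC : C ≪ Measure.pi fun _ : V => volume.restrict (Set.Icc (0 : ℝ) 1))
    (K : Finset V) :
    ∀ᵐ z ∂C.map K.restrict, z ∈ Set.univ.pi fun _ : K => Set.Icc (0 : ℝ) 1 := by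
  have hac := hC.map (Finset.measurable_restrict K)
  rw [map_restrict_pi_uniform] at hac
  exact hac.ae_le (ae_restrict_mem (MeasurableSet.univ_pi fun _ => measurableSet_Icc))

/-- The marginal is concentrated on the cube, so its Lebesgue density is also a density for the
uniform distribution. Integrating out single coordinates in the factorization requires such a
product of probability measures as reference. -/
theorem map_restrict_eq_withDensity_pi [IsFiniteMeasure C]
    (hC : C ≪ Measure.pi fun _ : V => volume.restrict (Set.Icc (0 : ℝ) 1))
    (K : Finset V) :
    C.map K.restrict =
      ((Measure.pi fun _ : V => volume.restrict (Set.Icc (0 : ℝ) 1)).map K.restrict).withDensity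
        (marginalDensity C K) := by
  rw [map_restrict_pi_uniform,
    ← restrict_withDensity (MeasurableSet.univ_pi fun _ => measurableSet_Icc),
    ← map_restrict_eq_withDensity hC,
    Measure.restrict_eq_self_of_ae_mem (ae_map_restrict_mem_cube hC K)]

theorem measure_preimage_restrict [IsFiniteMeasure C]
    (hC : C ≪ Measure.pi fun _ : V => volume.restrict (Set.Icc (0 : ℝ) 1))
    (K : Finset V) {E : Set (K → ℝ)} (hE : MeasurableSet E) :
    C (K.restrict ⁻¹' E) = ∫⁻ x in K.restrict ⁻¹' E, marginalDensity C K (K.restrict x)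
      ∂Measure.pi fun _ : V => volume.restrict (Set.Icc (0 : ℝ) 1) := by
  rw [← Measure.map_apply (Finset.measurable_restrict K) hE, map_restrict_eq_withDensity_pi hC,
    withDensity_apply _ hE,
    setLIntegral_map hE (measurable_marginalDensity K) (Finset.measurable_restrict K)]

/-- A marginal density vanishes where a marginal density of fewer coordinates does. -/
theorem marginalDensity_eq_zero_of_subset [IsFiniteMeasure C]
    (hC : C ≪ Measure.pi fun _ : V => volume.restrict (Set.Icc (0 : ℝ) 1))
    {S A : Finset V} (hSA : S ⊆ A) :
    ∀ᵐ x ∂Measure.pi fun _ : V => volume.restrict (Set.Icc (0 : ℝ) 1),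
      marginalDensity C S (S.restrict x) = 0 → marginalDensity C A (A.restrict x) = 0 := by
  let E : Set (S → ℝ) := marginalDensity C S ⁻¹' {0}
  have hE : MeasurableSet E := measurable_marginalDensity S (measurableSet_singleton 0)
  -- The event that the density of `S` vanishes has mass zero when computed with that density;
  -- computed with the density of `A`, this forces the latter to vanish there almost everywhere.
  have h1 := measure_preimage_restrict hC S hE
  have h2 := measure_preimage_restrict hC A (Finset.measurable_restrict₂ (X := fun _ => ℝ) hSA hE)
  have hpre : A.restrict ⁻¹' (Finset.restrict₂ (π := fun _ => ℝ) hSA ⁻¹' E) =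
      S.restrict (π := fun _ : V => ℝ) ⁻¹' E := rfl
  have hE' := Finset.measurable_restrict (X := fun _ : V => ℝ) S hE
  rw [hpre, h1, setLIntegral_congr_fun (g := fun _ => 0) hE' fun x hx => hx, lintegral_zero,
    eq_comm,
    setLIntegral_eq_zero_iff (f := fun x => marginalDensity C A (A.restrict x)) hE'
      ((measurable_marginalDensity A).comp (Finset.measurable_restrict A))] at h2
  exact h2

theorem marginalDensity_ne_top [IsFiniteMeasure C]
    (hC : C ≪ Measure.pi fun _ : V => volume.restrict (Set.Icc (0 : ℝ) 1))
    (K : Finset V) :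
    ∀ᵐ x ∂Measure.pi fun _ : V => volume.restrict (Set.Icc (0 : ℝ) 1),
      marginalDensity C K (K.restrict x) ≠ ∞ := by
  have h1 := measure_preimage_restrict hC K MeasurableSet.univ
  rw [Set.preimage_univ, Measure.restrict_univ] at h1
  filter_upwards [ae_lt_top ((measurable_marginalDensity K).comp (Finset.measurable_restrict K))
    (h1 ▸ measure_ne_top C _)] with x hx
  exact hx.ne

theorem absolutelyContinuous_volume
    (hC : C ≪ Measure.pi fun _ : V => volume.restrict (Set.Icc (0 : ℝ) 1)) : C ≪ volume := by
  rw [volume_pi]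
  refine hC.trans ?_
  rw [← Measure.restrict_pi_pi]
  exact Measure.restrict_le_self.absolutelyContinuous

/-- Both sides are densities of the finite measure `C` with respect to the uniform distribution on
the cube. -/
theorem rnDeriv_ae_eq_marginalDensity_univ [IsFiniteMeasure C]
    (hC : C ≪ Measure.pi fun _ : V => volume.restrict (Set.Icc (0 : ℝ) 1)) :
    ∀ᵐ x ∂Measure.pi fun _ : V => volume.restrict (Set.Icc (0 : ℝ) 1),
      C.rnDeriv volume x = marginalDensity C Finset.univ (Finset.univ.restrict x) := by
  have hcube : MeasurableSet (Set.univ.pi fun _ : V => Set.Icc (0 : ℝ) 1) :=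
    MeasurableSet.univ_pi fun _ => measurableSet_Icc
  have hpi : (Measure.pi fun _ : V => volume.restrict (Set.Icc (0 : ℝ) 1)) =
      volume.restrict (Set.univ.pi fun _ : V => Set.Icc (0 : ℝ) 1) := by
    rw [volume_pi, Measure.restrict_pi_pi]
  have hmem : ∀ᵐ x ∂C, x ∈ Set.univ.pi fun _ : V => Set.Icc (0 : ℝ) 1 := by
    rw [hpi] at hC
    exact hC.ae_le (ae_restrict_mem hcube)
  have h1 : C = (Measure.pi fun _ : V => volume.restrict (Set.Icc (0 : ℝ) 1)).withDensity
      (C.rnDeriv volume) := by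
    rw [hpi, ← restrict_withDensity hcube,
      Measure.withDensity_rnDeriv_eq _ _ (absolutelyContinuous_volume hC),
      Measure.restrict_eq_self_of_ae_mem hmem]
  have hm : Measurable fun x : V → ℝ => marginalDensity C Finset.univ (Finset.univ.restrict x) :=
    (measurable_marginalDensity _).comp (Finset.measurable_restrict _)
  have h2 : C = (Measure.pi fun _ : V => volume.restrict (Set.Icc (0 : ℝ) 1)).withDensity
      fun x => marginalDensity C Finset.univ (Finset.univ.restrict x) := by
    ext N hN
    have hmr : Measurable fun (w : ↥(Finset.univ : Finset V) → ℝ) (i : V) =>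
        w ⟨i, Finset.mem_univ i⟩ :=
      measurable_pi_lambda _ fun i => measurable_pi_apply _
    rw [withDensity_apply _ hN]
    exact measure_preimage_restrict hC Finset.univ (hmr hN)
  have h3 := h1.symm.trans h2
  refine (withDensity_eq_iff (Measure.measurable_rnDeriv _ _).aemeasurable hm.aemeasurable ?_).1 h3
  have h4 := congrArg (fun ρ => ρ Set.univ) h1
  simp only [withDensity_apply _ MeasurableSet.univ, Measure.restrict_univ] at h4
  rw [← h4]
  exact measure_ne_top _ _

/-- A product formula that holds on the unit cube holds everywhere. -/
theorem isJunctionTreeDistribution_of_ae_pi [DecidableEq V] [IsFiniteMeasure C]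
    (hC : C ≪ Measure.pi fun _ : V => volume.restrict (Set.Icc (0 : ℝ) 1))
    (T : JunctionTree V)
    (h : ∀ᵐ x ∂Measure.pi fun _ : V => volume.restrict (Set.Icc (0 : ℝ) 1),
      marginalDensity C Finset.univ (Finset.univ.restrict x) =
        (∏ K ∈ T.clusters, marginalDensity C K (K.restrict x)) /
          ∏ S ∈ T.separators, marginalDensity C S (S.restrict x) ^ (T.nu S - 1)) :
    IsJunctionTreeDistribution T C := by
  refine ⟨absolutelyContinuous_volume hC, ?_⟩
  have hcube : MeasurableSet (Set.univ.pi fun _ : V => Set.Icc (0 : ℝ) 1) :=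
    MeasurableSet.univ_pi fun _ => measurableSet_Icc
  have hin : ∀ᵐ x, x ∈ (Set.univ.pi fun _ : V => Set.Icc (0 : ℝ) 1) →
      C.rnDeriv volume x = (∏ K ∈ T.clusters, marginalDensity C K (K.restrict x)) /
          ∏ S ∈ T.separators, marginalDensity C S (S.restrict x) ^ (T.nu S - 1) := by
    rw [← ae_restrict_iff' hcube, volume_pi, Measure.restrict_pi_pi]
    filter_upwards [h, rnDeriv_ae_eq_marginalDensity_univ hC] with x h1 h2
    rw [← h1]
    exact h2
  have hout : ∀ K : Finset V, ∀ᵐ x : V → ℝ,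
      K.restrict x ∉ (Set.univ.pi fun _ : K => Set.Icc (0 : ℝ) 1) →
        marginalDensity C K (K.restrict x) = 0 := by
    intro K
    have h1 := ae_map_restrict_mem_cube hC K
    rw [map_restrict_eq_withDensity hC, ae_withDensity_iff (measurable_marginalDensity K)] at h1
    filter_upwards [(quasiMeasurePreserving_restrict K).ae h1] with x hx hx'
    by_contra h0
    exact hx' (hx h0)
  have hout' : ∀ᵐ x : V → ℝ, x ∉ (Set.univ.pi fun _ : V => Set.Icc (0 : ℝ) 1) →
      C.rnDeriv volume x = 0 := by
    have h1 : ∀ᵐ x ∂C, x ∈ Set.univ.pi fun _ : V => Set.Icc (0 : ℝ) 1 := by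
      rw [← Measure.restrict_pi_pi] at hC
      exact hC.ae_le (ae_restrict_mem hcube)
    rw [← Measure.withDensity_rnDeriv_eq C volume (absolutelyContinuous_volume hC),
      ae_withDensity_iff (Measure.measurable_rnDeriv _ _)] at h1
    filter_upwards [h1] with x hx hx'
    by_contra h0
    exact hx' (hx h0)
  filter_upwards [hin, ae_all_iff.2 hout, hout'] with x h1 h2 h3
  by_cases hx : x ∈ Set.univ.pi fun _ : V => Set.Icc (0 : ℝ) 1
  · exact h1 hx
  · rw [h3 hx]
    obtain ⟨i, hi⟩ : ∃ i, x i ∉ Set.Icc (0 : ℝ) 1 := by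
      by_contra! hall
      exact hx fun i _ => hall i
    -- Off the cube both sides are zero: a cluster containing a coordinate `i` with `x i` outside
    -- `[0, 1]` contributes a zero factor to the numerator.
    obtain ⟨K, hK, hiK⟩ := T.cover i
    rw [Finset.prod_eq_zero hK (h2 K fun hmem => hi (hmem ⟨i, hiK⟩ trivial)), ENNReal.zero_div]

/-- The product formula passes from a cherry tree to the preceding one if the linked clusters of
the latter are conditionally independent given their separator. -/
theorem ae_prod_formula_of_isNextCherryTree [DecidableEq V] [IsFiniteMeasure C]
    (hC : C ≪ Measure.pi fun _ : V => volume.restrict (Set.Icc (0 : ℝ) 1))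
    {T T' : JunctionTree V} {j : ℕ}
    (h : T.IsNextCherryTree T' j)
    (hci : ∀ A B : T.clusters, T.graph.Adj A B → ∀ a ∈ A.1 \ B.1, ∀ b ∈ B.1 \ A.1,
      CondIndepCoords C a b (A.1 ∩ B.1)) :
    ∀ᵐ x ∂Measure.pi fun _ : V => volume.restrict (Set.Icc (0 : ℝ) 1),
      (∏ K ∈ T'.clusters, marginalDensity C K (K.restrict x)) /
          ∏ S ∈ T'.separators, marginalDensity C S (S.restrict x) ^ (T'.nu S - 1) =
        (∏ K ∈ T.clusters, marginalDensity C K (K.restrict x)) /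
          ∏ S ∈ T.separators, marginalDensity C S (S.restrict x) ^ (T.nu S - 1) := by
  have hfac : ∀ p : T.clusters × T.clusters,
      ∀ᵐ x ∂Measure.pi fun _ : V => volume.restrict (Set.Icc (0 : ℝ) 1), T.graph.Adj p.1 p.2 →
        marginalDensity C (p.1.1 ∪ p.2.1) ((p.1.1 ∪ p.2.1).restrict x) =
          marginalDensity C p.1.1 (p.1.1.restrict x) * marginalDensity C p.2.1 (p.2.1.restrict x) /
            marginalDensity C (p.1.1 ∩ p.2.1) ((p.1.1 ∩ p.2.1).restrict x) := by
    rintro ⟨A, B⟩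
    by_cases hAB : T.graph.Adj A B
    · obtain ⟨a, ha, hA⟩ := h.isCherryTree.exists_insert_inter hAB
      obtain ⟨b, hb, hB⟩ := h.isCherryTree.exists_insert_inter hAB.symm
      rw [Finset.inter_comm] at hB
      filter_upwards [(hci A B hAB a ha b hb).density_union_ae_eq measurable_marginalDensity
        (map_restrict_eq_withDensity_pi hC) (Finset.mem_sdiff.1 ha).2 (Finset.mem_sdiff.1 hb).2
        hA hB] with x hx _ using hx
    · exact Filter.Eventually.of_forall fun x hx => absurd hx hAB
  have hzero : ∀ p : Finset V × Finset V,
      ∀ᵐ x ∂Measure.pi fun _ : V => volume.restrict (Set.Icc (0 : ℝ) 1), p.1 ⊆ p.2 →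
        marginalDensity C p.1 (p.1.restrict x) = 0 →
          marginalDensity C p.2 (p.2.restrict x) = 0 := by
    rintro ⟨S, A⟩
    by_cases hSA : S ⊆ A
    · filter_upwards [marginalDensity_eq_zero_of_subset hC hSA] with x hx _ using hx
    · exact Filter.Eventually.of_forall fun x hx => absurd hx hSA
  filter_upwards [ae_all_iff.2 hfac, ae_all_iff.2 hzero,
    ae_all_iff.2 (marginalDensity_ne_top hC)] with x h1 h2 h3
  exact h.ennreal_prod_div_prod (fun K => marginalDensity C K (K.restrict x)) h3
    (fun S A => h2 (S, A)) (fun A B => h1 (A, B))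

end Density

/-- The trees of a regular vine, completed by the tree with one cluster. -/
def completedVine {d : ℕ} (T : ℕ → JunctionTree (Fin d)) (j : ℕ) : JunctionTree (Fin d) :=
  if j < d then T j else JunctionTree.single (Fin d)

theorem IsRegularVine.isNextCherryTree {d : ℕ} {T : ℕ → JunctionTree (Fin d)}
    (hT : IsRegularVine T) {j : ℕ} (h1 : 1 ≤ j) (hj : j < d) :
    (completedVine T j).IsNextCherryTree (completedVine T (j + 1)) j := by
  rw [completedVine, if_pos hj, completedVine]
  split_ifs with hj'
  · exact ⟨hT.isCherryTree j h1 hj, hT.isCherryTree (j + 1) (by omega) hj',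
      hT.clusters_succ j h1 hj'⟩
  · exact (hT.isCherryTree j h1 hj).isNextCherryTree_single (by simp; omega)

theorem theorem5p7 (d k : ℕ) (hk : 1 ≤ k) (hkd : k < d) (C : Measure (Fin d → ℝ))
    (hC : IsTruncatedRegularVineCopula k C) :
    IsCherryTreeCopula (k + 1) C := by
  obtain ⟨P, hPprob, T, c, ⟨hP, hT, hc⟩, htrunc, hCP⟩ := hC
  have := hCP.1.1
  have hac := hCP.absolutelyContinuous hP
  have hci : ∀ j, k + 1 ≤ j → j < d → ∀ A B : (completedVine T j).clusters,
      (completedVine T j).graph.Adj A B → ∀ a ∈ A.1 \ B.1, ∀ b ∈ B.1 \ A.1,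
        CondIndepCoords C a b (A.1 ∩ B.1) := by
    intro j hkj hj
    rw [completedVine, if_pos hj]
    intro A B hAB a ha b hb
    -- The separator has size `j - 1 ≥ k`, so its pair copula is the independence copula.
    have hcard := (hT.isCherryTree j (by omega) hj).2 _ ((T j).mem_separators.2 ⟨A, B, hAB, rfl⟩)
    refine CondIndepCoords.copula hCP hP (condIndepCoords_of_condPairLaw ?_)
    filter_upwards [hc j (by omega) hj A B hAB a ha b hb] with z hz
    rwa [htrunc j (by omega) hj A B hAB (by omega) a ha b hb z] at hz
  refine ⟨hCP.1, completedVine T (k + 1), ?_, isJunctionTreeDistribution_of_ae_pi hac _ ?_⟩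
  · exact (hT.isNextCherryTree hk hkd).isCherryTree_next
  -- Descent from `j = d`, where the single cluster `V` makes the formula trivial, to `j = k + 1`.
  · refine Nat.decreasingInduction' (m := k + 1) (n := d)
      (P := fun j => ∀ᵐ x ∂Measure.pi fun _ : Fin d => volume.restrict (Set.Icc (0 : ℝ) 1),
        marginalDensity C Finset.univ (Finset.univ.restrict x) =
          (∏ K ∈ (completedVine T j).clusters, marginalDensity C K (K.restrict x)) /
            ∏ S ∈ (completedVine T j).separators,
              marginalDensity C S (S.restrict x) ^ ((completedVine T j).nu S - 1)) ?_ hkd ?_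
    · intro j hj hkj ih
      filter_upwards [ih, ae_prod_formula_of_isNextCherryTree hac
        (hT.isNextCherryTree (by omega) hj) (hci j hkj hj)] with x h1 h2
      rw [h1, h2]
    · rw [completedVine, if_neg (lt_irrefl d)]
      exact Filter.Eventually.of_forall fun x => by simp
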